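/- Let $\Bbbk$ be a field. Let $\mathcal{TL}_0(\Bbbk)$ be the strict $\Bbbk$-linear monoidal category with objects $\mathbb N$, $m\otimes n=m+n$ and unit $0$, whose morphisms are generated by $\mathrm{cup}\colon 0\to 2$ and $\mathrm{cap}\colon 2\to 0$ subject to $$(\mathrm{id}_1\otimes\mathrm{cap})\circ(\mathrm{cup}\otimes\mathrm{id}_1)=0=(\mathrm{cap}\otimes\mathrm{id}_1)\circ(\mathrm{id}_1\otimes\mathrm{cup}),\qquad \mathrm{cap}\circ\mathrm{cup}=\mathrm{id}_0 .$$ Let $f\mapsto\overline f$ be the contravariant $\Bbbk$-linear monoidal involution that is the identity on objects and exchanges $\mathrm{cup}$ and $\mathrm{cap}$. A *cap diagram* is a non-zero morphism obtained from $\mathrm{cap}$ and identities by $\otimes$ and $\circ$; equivalently, it is a noncrossing diagram in which each of the $n$ bottom points is either joined to another bottom point by a cap or is the end of a through-strand, no through-strand lying below a cap. Let $\mathscr D_n$ be the (finite) set of cap diagrams with domain $n$, and let $\mathtt{th}(x)$ be the number of through-strands of $x$, so that $x\colon n\to\mathtt{th}(x)$. For $n\in\mathbb N$ the *Jones–Wenzl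 projector* is $$j_n=\sum_{I}(-1)^{|I|}\,\overline{\mathrm{cap}_{I,n}}\circ\mathrm{cap}_{I,n}\in\mathrm{End}(n),$$ where $I$ runs over the subsets of $\{1,\dots,n-1\}$ containing no two consecutive numbers and $\mathrm{cap}_{I,n}$ is the cap diagram on $n$ strands with caps joining $i$ and $i+1$ for $i\in I$ and no other caps. For $x\in\mathscr D_{m+n}$ let $x_{\le m}\in\mathscr D_m$ (resp. $x_{>m}\in\mathscr D_n$) be obtained by deleting the last $n$ (resp. the first $m$) strands and turning the remaining half-caps into through-strands, and let $\mathtt{hk}_m(x)$ be the number $l$ with $\mathtt{th}(x)+2l=\mathtt{th}(x_{\le m})+\mathtt{th}(x_{>m})$. For $y\in\mathscr D_n$, $z\in\mathscr D_m$ and $l\le\min(\mathtt{th}(y),\mathtt{th}(z))$ let $y\odot_l z\in\mathscr D_{n+m}$ be obtained by placing $z$ to the right of $y$ and then, $l$ times, joining the rightmost remaining through-strand of $y$ and the leftmost remaining through-strand of $z$ by a cap. Put $$\kappa_{m,n}(x)=x_{>m}\odot_{\mathtt{hk}_m(x)}x_{\le m}\in\mathscr D_{n+m};$$ it satisfies $\mathtt{th}(\kappa_{m,n}(x))=\mathtt{th}(x)$.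 **Theorem.** The maps $$\sigma_{m,n}=\sum_{x\in\mathscr D_{m+n}}\overline{\kappa_{m,n}(x)}\circ j_{\mathtt{th}(x)}\circ x\;\colon\; m\otimes n\to n\otimes m\qquad(m,n\in\mathbb N)$$ are isomorphisms, natural in $m$ and $n$, and make $\mathcal{TL}_0(\Bbbk)$ a coboundary category; that is, for all $r,s,t,m,n\in\mathbb N$: 1. (symmetry) $\sigma_{n,m}\circ\sigma_{m,n}=\mathrm{id}_{m\otimes n}$; 2. (unit) $\sigma_{0,n}$ is the canonical isomorphism $0\otimes n\to n\otimes 0$ (the composite of the unit isomorphisms, here $\mathrm{id}_n$); 3. (cactus) $\sigma_{r,\,t\otimes s}\circ(\mathrm{id}_r\otimes\sigma_{s,t})=\sigma_{s\otimes r,\,t}\circ(\sigma_{r,s}\otimes\mathrm{id}_t)$ as morphisms $r\otimes s\otimes t\to t\otimes s\otimes r$ (associators, which are identities, omitted). -/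

import Mathlib

open CategoryTheory MonoidalCategory

universe u

/-! ### The category `TL₀(𝕜)` by generators and relations -/

/-- Formal morphisms `m → n`: the expressions built from `cup : 0 → 2`, `cap : 2 → 0` and identities
by composition, tensor product and linear combinations. -/
inductive TLTerm (k : Type u) : ℕ → ℕ → Type u
  | id (n : ℕ) : TLTerm k n n
  | cup : TLTerm k 0 2
  | cap : TLTerm k 2 0
  | comp {l m n : ℕ} (f : TLTerm k l m) (g : TLTerm k m n) : TLTerm k l n
  | tensor {m n m' n' : ℕ} (f : TLTerm k m n) (g : TLTerm k m' n') : TLTerm k (m + m') (n + n')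
  | zero (m n : ℕ) : TLTerm k m n
  | add {m n : ℕ} (f g : TLTerm k m n) : TLTerm k m n
  | smul {m n : ℕ} (a : k) (f : TLTerm k m n) : TLTerm k m n

/-- The identity of `m`, viewed as a formal morphism `m → n` along an equality `m = n`. -/
def TLTerm.ofEq (k : Type u) {m n : ℕ} (h : m = n) : TLTerm k m n := h ▸ TLTerm.id m

/-- The congruence on formal morphisms generated by the axioms of a strict `k`-linear monoidal
category and by the relations between `cup` and `cap`: both zig-zags are `0` and the circle is the
identity of `0` (the relations `zig-zag = q` and `circle = q² + 1` at `q = 0`).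
Composition is written in diagrammatic order (`comp f g` is `g ∘ f`). -/
inductive TLRel (k : Type u) [Field k] : {m n : ℕ} → TLTerm k m n → TLTerm k m n → Prop
  -- congruence
  | refl {m n : ℕ} (f : TLTerm k m n) : TLRel k f f
  | symm {m n : ℕ} {f g : TLTerm k m n} : TLRel k f g → TLRel k g f
  | trans {m n : ℕ} {f g h : TLTerm k m n} : TLRel k f g → TLRel k g h → TLRel k f h
  | comp_congr {l m n : ℕ} {f f' : TLTerm k l m} {g g' : TLTerm k m n} :
      TLRel k f f' → TLRel k g g' → TLRel k (f.comp g) (f'.comp g')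
  | tensor_congr {m n m' n' : ℕ} {f f' : TLTerm k m n} {g g' : TLTerm k m' n'} :
      TLRel k f f' → TLRel k g g' → TLRel k (f.tensor g) (f'.tensor g')
  | add_congr {m n : ℕ} {f f' g g' : TLTerm k m n} :
      TLRel k f f' → TLRel k g g' → TLRel k (f.add g) (f'.add g')
  | smul_congr {m n : ℕ} (a : k) {f f' : TLTerm k m n} :
      TLRel k f f' → TLRel k (f.smul a) (f'.smul a)
  -- category
  | id_comp {m n : ℕ} (f : TLTerm k m n) : TLRel k ((TLTerm.id m).comp f) f
  | comp_id {m n : ℕ} (f : TLTerm k m n) : TLRel k (f.comp (TLTerm.id n)) f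
  | comp_assoc {l m n p : ℕ} (f : TLTerm k l m) (g : TLTerm k m n) (h : TLTerm k n p) :
      TLRel k ((f.comp g).comp h) (f.comp (g.comp h))
  -- vector space structure of the morphism spaces
  | add_assoc {m n : ℕ} (f g h : TLTerm k m n) : TLRel k ((f.add g).add h) (f.add (g.add h))
  | add_comm {m n : ℕ} (f g : TLTerm k m n) : TLRel k (f.add g) (g.add f)
  | zero_add {m n : ℕ} (f : TLTerm k m n) : TLRel k ((TLTerm.zero m n).add f) f
  | smul_add {m n : ℕ} (a : k) (f g : TLTerm k m n) :
      TLRel k ((f.add g).smul a) ((f.smul a).add (g.smul a))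
  | add_smul {m n : ℕ} (a b : k) (f : TLTerm k m n) :
      TLRel k (f.smul (a + b)) ((f.smul a).add (f.smul b))
  | mul_smul {m n : ℕ} (a b : k) (f : TLTerm k m n) :
      TLRel k (f.smul (a * b)) ((f.smul b).smul a)
  | one_smul {m n : ℕ} (f : TLTerm k m n) : TLRel k (f.smul 1) f
  | zero_smul {m n : ℕ} (f : TLTerm k m n) : TLRel k (f.smul 0) (TLTerm.zero m n)
  -- bilinearity of composition and tensor product
  | add_comp {l m n : ℕ} (f f' : TLTerm k l m) (g : TLTerm k m n) :
      TLRel k ((f.add f').comp g) ((f.comp g).add (f'.comp g))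
  | comp_add {l m n : ℕ} (f : TLTerm k l m) (g g' : TLTerm k m n) :
      TLRel k (f.comp (g.add g')) ((f.comp g).add (f.comp g'))
  | smul_comp {l m n : ℕ} (a : k) (f : TLTerm k l m) (g : TLTerm k m n) :
      TLRel k ((f.smul a).comp g) ((f.comp g).smul a)
  | comp_smul {l m n : ℕ} (a : k) (f : TLTerm k l m) (g : TLTerm k m n) :
      TLRel k (f.comp (g.smul a)) ((f.comp g).smul a)
  | add_tensor {m n m' n' : ℕ} (f f' : TLTerm k m n) (g : TLTerm k m' n') :
      TLRel k ((f.add f').tensor g) ((f.tensor g).add (f'.tensor g))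
  | tensor_add {m n m' n' : ℕ} (f : TLTerm k m n) (g g' : TLTerm k m' n') :
      TLRel k (f.tensor (g.add g')) ((f.tensor g).add (f.tensor g'))
  | smul_tensor {m n m' n' : ℕ} (a : k) (f : TLTerm k m n) (g : TLTerm k m' n') :
      TLRel k ((f.smul a).tensor g) ((f.tensor g).smul a)
  | tensor_smul {m n m' n' : ℕ} (a : k) (f : TLTerm k m n) (g : TLTerm k m' n') :
      TLRel k (f.tensor (g.smul a)) ((f.tensor g).smul a)
  -- functoriality of the tensor product
  | tensor_id (m n : ℕ) : TLRel k ((TLTerm.id m).tensor (TLTerm.id n)) (TLTerm.id (m + n))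
  | tensor_comp {l m n l' m' n' : ℕ} (f : TLTerm k l m) (g : TLTerm k m n)
      (f' : TLTerm k l' m') (g' : TLTerm k m' n') :
      TLRel k ((f.comp g).tensor (f'.comp g')) ((f.tensor f').comp (g.tensor g'))
  -- strict associativity and strict units
  | tensor_assoc {m n m' n' m'' n'' : ℕ} (f : TLTerm k m n) (g : TLTerm k m' n')
      (h : TLTerm k m'' n'') :
      TLRel k (((f.tensor g).tensor h).comp (TLTerm.ofEq k (Nat.add_assoc n n' n'')))
        ((TLTerm.ofEq k (Nat.add_assoc m m' m'')).comp (f.tensor (g.tensor h)))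
  | zero_tensor {m n : ℕ} (f : TLTerm k m n) :
      TLRel k (((TLTerm.id 0).tensor f).comp (TLTerm.ofEq k (Nat.zero_add n)))
        ((TLTerm.ofEq k (Nat.zero_add m)).comp f)
  | tensor_zero {m n : ℕ} (f : TLTerm k m n) : TLRel k (f.tensor (TLTerm.id 0)) f
  -- the relations between the generators
  | zigzag_left : TLRel k
      ((TLTerm.cup.tensor (TLTerm.id 1)).comp ((TLTerm.id 1).tensor TLTerm.cap) : TLTerm k 1 1)
      (TLTerm.zero 1 1)
  | zigzag_right : TLRel k
      (((TLTerm.id 1).tensor TLTerm.cup).comp (TLTerm.cap.tensor (TLTerm.id 1)) : TLTerm k 1 1)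
      (TLTerm.zero 1 1)
  | circle : TLRel k (TLTerm.cup.comp TLTerm.cap) (TLTerm.id 0)

/-- The category `TL₀(k)`: its objects are the natural numbers. -/
structure TL0 (k : Type u) [Field k] : Type where
  /-- The natural number `n` as an object of `TL₀(k)`. -/
  obj ::
  /-- The number of strands. -/
  strands : ℕ

namespace TL0

variable (k : Type u) [Field k]

/-- The morphism space `Hom(m, n)` of `TL₀(k)`. -/
def Hom (m n : ℕ) : Type u := Quot (TLRel k (m := m) (n := n))

variable {k}

/-- The morphism represented by an expression. -/
def mk {m n : ℕ} (f : TLTerm k m n) : Hom k m n := Quot.mk _ f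

theorem mk_eq {m n : ℕ} {f g : TLTerm k m n} (h : TLRel k f g) : mk f = mk g := Quot.sound h

theorem mk_surj {m n : ℕ} (f : Hom k m n) : ∃ t, mk t = f := Quot.exists_rep f

def compHom {l m n : ℕ} : Hom k l m → Hom k m n → Hom k l n :=
  Quot.map₂ TLTerm.comp (fun f _ _ h => .comp_congr (.refl f) h)
    (fun _ _ g h => .comp_congr h (.refl g))

def tensorHom {m n m' n' : ℕ} : Hom k m n → Hom k m' n' → Hom k (m + m') (n + n') :=
  Quot.map₂ TLTerm.tensor (fun f _ _ h => .tensor_congr (.refl f) h)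
    (fun _ _ g h => .tensor_congr h (.refl g))

def addHom {m n : ℕ} : Hom k m n → Hom k m n → Hom k m n :=
  Quot.map₂ TLTerm.add (fun f _ _ h => .add_congr (.refl f) h)
    (fun _ _ g h => .add_congr h (.refl g))

def smulHom {m n : ℕ} (a : k) : Hom k m n → Hom k m n :=
  Quot.map (TLTerm.smul a) (fun _ _ h => .smul_congr a h)

theorem smul_zeroHom {m n : ℕ} (a : k) :
    smulHom a (mk (TLTerm.zero m n) : Hom k m n) = mk (TLTerm.zero m n) := by
  have h0 : (mk (TLTerm.zero m n) : Hom k m n) = mk ((TLTerm.zero m n).smul 0) :=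
    (mk_eq (.zero_smul _)).symm
  have h1 : (mk ((TLTerm.zero m n).smul (a * 0)) : Hom k m n) =
      mk (((TLTerm.zero m n).smul 0).smul a) := mk_eq (.mul_smul a 0 _)
  rw [mul_zero] at h1
  calc smulHom a (mk (TLTerm.zero m n) : Hom k m n)
      = smulHom a (mk ((TLTerm.zero m n).smul 0)) := by rw [← h0]
    _ = mk ((TLTerm.zero m n).smul 0) := h1.symm
    _ = _ := h0.symm

theorem add_negHom {m n : ℕ} (f : Hom k m n) :
    addHom (smulHom (-1) f) f = mk (TLTerm.zero m n) := by
  obtain ⟨f, rfl⟩ := mk_surj f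
  have h1 : (mk (f.smul ((-1 : k) + 1)) : Hom k m n) = mk ((f.smul (-1)).add (f.smul 1)) :=
    mk_eq (.add_smul _ _ f)
  have h2 : (mk ((f.smul (-1)).add (f.smul 1)) : Hom k m n) = mk ((f.smul (-1)).add f) :=
    mk_eq (.add_congr (.refl _) (.one_smul f))
  rw [neg_add_cancel] at h1
  exact h2.symm.trans (h1.symm.trans (mk_eq (.zero_smul f)))

instance (m n : ℕ) : Zero (Hom k m n) := ⟨mk (TLTerm.zero m n)⟩
instance (m n : ℕ) : Add (Hom k m n) := ⟨addHom⟩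
instance (m n : ℕ) : Neg (Hom k m n) := ⟨smulHom (-1)⟩

instance (m n : ℕ) : AddCommGroup (Hom k m n) where
  nsmul := nsmulRec
  zsmul := zsmulRec
  add_assoc f g h := by
    obtain ⟨f, rfl⟩ := mk_surj f
    obtain ⟨g, rfl⟩ := mk_surj g
    obtain ⟨h, rfl⟩ := mk_surj h
    exact mk_eq (.add_assoc f g h)
  zero_add f := by
    obtain ⟨f, rfl⟩ := mk_surj f
    exact mk_eq (.zero_add f)
  add_zero f := by
    obtain ⟨f, rfl⟩ := mk_surj f
    exact mk_eq (.trans (.add_comm f _) (.zero_add f))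
  neg_add_cancel f := add_negHom f
  add_comm f g := by
    obtain ⟨f, rfl⟩ := mk_surj f
    obtain ⟨g, rfl⟩ := mk_surj g
    exact mk_eq (.add_comm f g)

instance (m n : ℕ) : Module k (Hom k m n) where
  smul := smulHom
  one_smul f := by
    obtain ⟨f, rfl⟩ := mk_surj f
    exact mk_eq (.one_smul f)
  mul_smul a b f := by
    obtain ⟨f, rfl⟩ := mk_surj f
    exact mk_eq (.mul_smul a b f)
  smul_zero a := smul_zeroHom a
  smul_add a f g := by
    obtain ⟨f, rfl⟩ := mk_surj f
    obtain ⟨g, rfl⟩ := mk_surj g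
    exact mk_eq (.smul_add a f g)
  add_smul a b f := by
    obtain ⟨f, rfl⟩ := mk_surj f
    exact mk_eq (.add_smul a b f)
  zero_smul f := by
    obtain ⟨f, rfl⟩ := mk_surj f
    exact mk_eq (.zero_smul f)

instance : Category.{u} (TL0 k) where
  Hom X Y := Hom k X.strands Y.strands
  id X := mk (TLTerm.id X.strands)
  comp := compHom
  id_comp f := by
    obtain ⟨f, rfl⟩ := mk_surj f
    exact mk_eq (.id_comp f)
  comp_id f := by
    obtain ⟨f, rfl⟩ := mk_surj f
    exact mk_eq (.comp_id f)
  assoc f g h := by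
    obtain ⟨f, rfl⟩ := mk_surj f
    obtain ⟨g, rfl⟩ := mk_surj g
    obtain ⟨h, rfl⟩ := mk_surj h
    exact mk_eq (.comp_assoc f g h)

instance : Preadditive (TL0 k) where
  homGroup X Y := inferInstanceAs (AddCommGroup (Hom k X.strands Y.strands))
  add_comp _ _ _ f f' g := by
    obtain ⟨f, rfl⟩ := mk_surj f
    obtain ⟨f', rfl⟩ := mk_surj f'
    obtain ⟨g, rfl⟩ := mk_surj g
    exact mk_eq (.add_comp f f' g)
  comp_add _ _ _ f g g' := by
    obtain ⟨f, rfl⟩ := mk_surj f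
    obtain ⟨g, rfl⟩ := mk_surj g
    obtain ⟨g', rfl⟩ := mk_surj g'
    exact mk_eq (.comp_add f g g')

instance : Linear k (TL0 k) where
  homModule X Y := inferInstanceAs (Module k (Hom k X.strands Y.strands))
  smul_comp _ _ _ a f g := by
    obtain ⟨f, rfl⟩ := mk_surj f
    obtain ⟨g, rfl⟩ := mk_surj g
    exact mk_eq (.smul_comp a f g)
  comp_smul _ _ _ f a g := by
    obtain ⟨f, rfl⟩ := mk_surj f
    obtain ⟨g, rfl⟩ := mk_surj g
    exact mk_eq (.comp_smul a f g)

theorem mk_ofEq {m n : ℕ} (h : m = n) :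
    (mk (TLTerm.ofEq k h) : Hom k m n) =
      (eqToHom (congrArg obj h) : (obj m : TL0 k) ⟶ obj n) := by
  subst h; rfl

/-- The strict tensor product: `m ⊗ n = m + n` on objects, with unit `0`; the structure isomorphisms
are the identities. -/
instance : MonoidalCategoryStruct (TL0 k) where
  tensorObj X Y := obj (X.strands + Y.strands)
  tensorUnit := obj 0
  tensorHom f g := tensorHom f g
  whiskerLeft X _ _ f := tensorHom (mk (TLTerm.id X.strands)) f
  whiskerRight f X := tensorHom f (mk (TLTerm.id X.strands))
  associator X Y Z := eqToIso (congrArg obj (Nat.add_assoc X.strands Y.strands Z.strands))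
  leftUnitor X := eqToIso (congrArg obj (Nat.zero_add X.strands))
  rightUnitor X := eqToIso (congrArg obj (Nat.add_zero X.strands))

theorem associator_hom (X Y Z : TL0 k) : (α_ X Y Z).hom =
    eqToHom (congrArg obj (Nat.add_assoc X.strands Y.strands Z.strands)) := rfl

theorem leftUnitor_hom (X : TL0 k) :
    (λ_ X).hom = eqToHom (congrArg obj (Nat.zero_add X.strands)) := rfl

theorem rightUnitor_hom (X : TL0 k) :
    (ρ_ X).hom = eqToHom (congrArg obj (Nat.add_zero X.strands)) := rfl

theorem tensor_eqToHom {X Y X' Y' : TL0 k} (h : X = Y) (h' : X' = Y') :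
    (eqToHom h ⊗ₘ eqToHom h') = eqToHom (congrArg₂ (· ⊗ ·) h h') := by
  subst h h'; exact mk_eq (.tensor_id _ _)

instance : MonoidalCategory (TL0 k) := MonoidalCategory.ofTensorHom
  (id_tensorHom_id := fun _ _ => mk_eq (.tensor_id _ _))
  (tensorHom_comp_tensorHom := fun f f' g g' => by
    obtain ⟨f, rfl⟩ := mk_surj f
    obtain ⟨g, rfl⟩ := mk_surj g
    obtain ⟨f', rfl⟩ := mk_surj f'
    obtain ⟨g', rfl⟩ := mk_surj g'
    exact (mk_eq (.tensor_comp f g f' g')).symm)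
  (associator_naturality := fun f g h => by
    obtain ⟨f, rfl⟩ := mk_surj f
    obtain ⟨g, rfl⟩ := mk_surj g
    obtain ⟨h, rfl⟩ := mk_surj h
    have e : compHom (mk ((f.tensor g).tensor h)) (mk (TLTerm.ofEq k (Nat.add_assoc _ _ _))) =
      compHom (mk (TLTerm.ofEq k (Nat.add_assoc _ _ _))) (mk (f.tensor (g.tensor h))) :=
      mk_eq (.tensor_assoc f g h)
    rw [mk_ofEq, mk_ofEq] at e
    exact e)
  (leftUnitor_naturality := fun f => by
    obtain ⟨f, rfl⟩ := mk_surj f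
    have e : compHom (mk ((TLTerm.id 0).tensor f)) (mk (TLTerm.ofEq k (Nat.zero_add _))) =
      compHom (mk (TLTerm.ofEq k (Nat.zero_add _))) (mk f) := mk_eq (.zero_tensor f)
    rw [mk_ofEq, mk_ofEq] at e
    exact e)
  (rightUnitor_naturality := fun {X Y} f => by
    obtain ⟨f, rfl⟩ := mk_surj f
    exact mk_eq (.trans (.comp_id _) (.trans (.tensor_zero f) (.symm (.id_comp f)))))
  (pentagon := fun X Y Z W => by
    simp only [associator_hom, ← eqToHom_refl W rfl, ← eqToHom_refl X rfl, tensor_eqToHom,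
      eqToHom_trans])
  (triangle := fun X Y => by
    simp only [associator_hom, leftUnitor_hom, rightUnitor_hom, ← eqToHom_refl Y rfl,
      ← eqToHom_refl X rfl, tensor_eqToHom, eqToHom_trans])

instance : MonoidalPreadditive (TL0 k) where
  whiskerLeft_zero {X Y Z} := by
    refine (mk_eq (.tensor_congr (.refl _) (.symm (.zero_smul (TLTerm.zero _ _))))).trans ?_
    exact (mk_eq (.tensor_smul _ _ _)).trans (mk_eq (.zero_smul _))
  zero_whiskerRight {X Y Z} := by
    refine (mk_eq (.tensor_congr (.symm (.zero_smul (TLTerm.zero _ _))) (.refl _))).trans ?_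
    exact (mk_eq (.smul_tensor _ _ _)).trans (mk_eq (.zero_smul _))
  whiskerLeft_add f g := by
    obtain ⟨f, rfl⟩ := mk_surj f
    obtain ⟨g, rfl⟩ := mk_surj g
    exact mk_eq (.tensor_add _ f g)
  add_whiskerRight f g := by
    obtain ⟨f, rfl⟩ := mk_surj f
    obtain ⟨g, rfl⟩ := mk_surj g
    exact mk_eq (.add_tensor f g _)

instance : MonoidalLinear k (TL0 k) where
  whiskerLeft_smul _ _ _ a f := by
    obtain ⟨f, rfl⟩ := mk_surj f
    exact mk_eq (.tensor_smul a _ f)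
  smul_whiskerRight a _ _ f _ := by
    obtain ⟨f, rfl⟩ := mk_surj f
    exact mk_eq (.smul_tensor a f _)

/-- The generating morphism `cup : 0 → 2`. -/
def cup : (obj 0 : TL0 k) ⟶ obj 2 := mk TLTerm.cup

/-- The generating morphism `cap : 2 → 0`. -/
def cap : (obj 2 : TL0 k) ⟶ obj 0 := mk TLTerm.cap

end TL0

/-! ### The contravariant involution `f ↦ \overline f` -/

/-- Reflection of expressions in a horizontal line, exchanging `cup` and `cap`. -/
def TLTerm.bar {k : Type u} : {m n : ℕ} → TLTerm k m n → TLTerm k n m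
  | _, _, .id n => .id n
  | _, _, .cup => .cap
  | _, _, .cap => .cup
  | _, _, .comp f g => .comp g.bar f.bar
  | _, _, .tensor f g => .tensor f.bar g.bar
  | _, _, .zero m n => .zero n m
  | _, _, .add f g => .add f.bar g.bar
  | _, _, .smul a f => .smul a f.bar

theorem TLTerm.bar_ofEq {k : Type u} {m n : ℕ} (h : m = n) :
    (TLTerm.ofEq k h).bar = TLTerm.ofEq k h.symm := by
  subst h; rfl

/-- Naturality of the (identity) structure isomorphisms may be read backwards. -/
theorem TLRel.ofEq_comp {k : Type u} [Field k] {m n m' n' : ℕ} (h : m = m') (h' : n = n')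
    {f : TLTerm k m n} {g : TLTerm k m' n'}
    (H : TLRel k (f.comp (.ofEq k h')) ((TLTerm.ofEq k h).comp g)) :
    TLRel k ((TLTerm.ofEq k h.symm).comp f) (g.comp (.ofEq k h'.symm)) := by
  subst h h'
  exact .trans (.id_comp f) (.trans (.symm (.comp_id f)) (.trans H (.trans (.id_comp g)
    (.symm (.comp_id g)))))

theorem TLRel.bar {k : Type u} [Field k] {m n : ℕ} {f g : TLTerm k m n} (h : TLRel k f g) :
    TLRel k f.bar g.bar := by
  induction h with
  | refl f => exact .refl _
  | symm _ ih => exact .symm ih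
  | trans _ _ ih ih' => exact .trans ih ih'
  | comp_congr _ _ ih ih' => exact .comp_congr ih' ih
  | tensor_congr _ _ ih ih' => exact .tensor_congr ih ih'
  | add_congr _ _ ih ih' => exact .add_congr ih ih'
  | smul_congr a _ ih => exact .smul_congr a ih
  | id_comp f => exact .comp_id _
  | comp_id f => exact .id_comp _
  | comp_assoc f g h => exact .symm (.comp_assoc _ _ _)
  | add_assoc f g h => exact .add_assoc _ _ _
  | add_comm f g => exact .add_comm _ _
  | zero_add f => exact .zero_add _
  | smul_add a f g => exact .smul_add _ _ _
  | add_smul a b f => exact .add_smul _ _ _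
  | mul_smul a b f => exact .mul_smul _ _ _
  | one_smul f => exact .one_smul _
  | zero_smul f => exact .zero_smul _
  | add_comp f f' g => exact .comp_add _ _ _
  | comp_add f g g' => exact .add_comp _ _ _
  | smul_comp a f g => exact .comp_smul _ _ _
  | comp_smul a f g => exact .smul_comp _ _ _
  | add_tensor f f' g => exact .add_tensor _ _ _
  | tensor_add f g g' => exact .tensor_add _ _ _
  | smul_tensor a f g => exact .smul_tensor _ _ _
  | tensor_smul a f g => exact .tensor_smul _ _ _
  | tensor_id m n => exact .tensor_id _ _
  | tensor_comp f g f' g' => exact .tensor_comp _ _ _ _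
  | tensor_assoc f g h =>
    simp only [TLTerm.bar, TLTerm.bar_ofEq]
    exact .ofEq_comp _ _ (.tensor_assoc f.bar g.bar h.bar)
  | zero_tensor f =>
    simp only [TLTerm.bar, TLTerm.bar_ofEq]
    exact .ofEq_comp _ _ (.zero_tensor f.bar)
  | tensor_zero f => exact .tensor_zero _
  | zigzag_left => exact .zigzag_right
  | zigzag_right => exact .zigzag_left
  | circle => exact .circle

/-- The contravariant `k`-linear monoidal involution of `TL₀(k)` which is the identity on objects and
exchanges `cup` and `cap`. -/
def TL0.bar {k : Type u} [Field k] {X Y : TL0 k} : (X ⟶ Y) → (Y ⟶ X) :=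
  Quot.map TLTerm.bar (fun _ _ h => h.bar)

/-! ### Cap diagrams -/

/-- Cap diagrams with `n` strands at the bottom, `t` of which are through-strands: noncrossing
diagrams in which every strand is either capped with another strand or is a through-strand (so no
through-strand lies below a cap). They are built by adding strands on the right: every cap diagram
on `n + 1` strands arises in exactly one way from one on `n` strands, by adding a last strand which
either is a through-strand, or is joined by a cap with the rightmost through-strand. -/
inductive CapDiagramTo : ℕ → ℕ → Type
  | nil : CapDiagramTo 0 0
  | through {n t : ℕ} (x : CapDiagramTo n t) : CapDiagramTo (n + 1) (t + 1)
  | close {n t : ℕ} (x : CapDiagramTo n (t + 1)) : CapDiagramTo (n + 1) t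

/-- The morphism `n → t` of `TL₀(k)` depicted by a cap diagram. -/
def CapDiagramTo.toHom (k : Type u) [Field k] :
    {n t : ℕ} → CapDiagramTo n t → ((TL0.obj n : TL0 k) ⟶ TL0.obj t)
  | _, _, .nil => 𝟙 (TL0.obj 0)
  | _, _, .through x => x.toHom k ▷ TL0.obj 1
  | _, _, .close (t := t) x => (x.toHom k ▷ TL0.obj 1) ≫ (TL0.obj t ◁ TL0.cap)

/-! The next facts show that cap diagrams, as defined above, are exactly the non-zero morphisms of
`TL₀(k)` obtained from `cap` and identities by tensor product and composition. -/

/-- The morphisms obtained from `cap` and identity morphisms by tensor product and composition. -/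
inductive TL0.IsCapGenerated {k : Type u} [Field k] : {X Y : TL0 k} → (X ⟶ Y) → Prop
  | id (X : TL0 k) : IsCapGenerated (𝟙 X)
  | cap : IsCapGenerated TL0.cap
  | tensor {X Y X' Y' : TL0 k} {f : X ⟶ Y} {g : X' ⟶ Y'} :
      IsCapGenerated f → IsCapGenerated g → IsCapGenerated (f ⊗ₘ g)
  | comp {X Y Z : TL0 k} {f : X ⟶ Y} {g : Y ⟶ Z} :
      IsCapGenerated f → IsCapGenerated g → IsCapGenerated (f ≫ g)

/-- The matrix of an expression in the representation of `TL₀(k)` on tensor powers of a vector space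
with basis `e_true, e_false`, where `cap` sends `e_true ⊗ e_false` to `1` and the other basis vectors
to `0`, and `cup` sends `1` to `e_true ⊗ e_false`. -/
noncomputable def TLTerm.mat {k : Type u} [Field k] :
    {m n : ℕ} → TLTerm k m n → Matrix (Fin m → Bool) (Fin n → Bool) k
  | _, _, .id n => 1
  | _, _, .cup => .of fun _ v => if v 0 = true ∧ v 1 = false then 1 else 0
  | _, _, .cap => .of fun u _ => if u 0 = true ∧ u 1 = false then 1 else 0
  | _, _, .comp f g => f.mat * g.mat
  | _, _, .tensor f g => .of fun u v =>
      f.mat (fun i => u (i.castAdd _)) (fun i => v (i.castAdd _)) *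
        g.mat (fun i => u (i.natAdd _)) (fun i => v (i.natAdd _))
  | _, _, .zero m n => 0
  | _, _, .add f g => f.mat + g.mat
  | _, _, .smul a f => a • f.mat

theorem TLTerm.mat_comp_ofEq {k : Type u} [Field k] {m n n' : ℕ} (h : n = n') (f : TLTerm k m n)
    (u : Fin m → Bool) (v : Fin n' → Bool) :
    (f.comp (TLTerm.ofEq k h)).mat u v = f.mat u (fun i => v (i.cast h)) := by
  subst h; simp [TLTerm.ofEq, TLTerm.mat]

theorem TLTerm.mat_ofEq_comp {k : Type u} [Field k] {m m' n : ℕ} (h : m = m') (f : TLTerm k m' n)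
    (u : Fin m → Bool) (v : Fin n → Bool) :
    ((TLTerm.ofEq k h).comp f).mat u v = f.mat (fun i => u (i.cast h.symm)) v := by
  subst h; simp [TLTerm.ofEq, TLTerm.mat]

theorem TLRel.mat_eq {k : Type u} [Field k] {m n : ℕ} {f g : TLTerm k m n} (h : TLRel k f g) :
    f.mat = g.mat := by
  induction h with
  | refl f => rfl
  | symm _ ih => exact ih.symm
  | trans _ _ ih ih' => exact ih.trans ih'
  | comp_congr _ _ ih ih' => simp [TLTerm.mat, ih, ih']
  | tensor_congr _ _ ih ih' => simp only [TLTerm.mat, ih, ih']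
  | add_congr _ _ ih ih' => simp [TLTerm.mat, ih, ih']
  | smul_congr a _ ih => simp [TLTerm.mat, ih]
  | id_comp f => simp [TLTerm.mat]
  | comp_id f => simp [TLTerm.mat]
  | comp_assoc f g h => simp [TLTerm.mat, Matrix.mul_assoc]
  | add_assoc f g h => simp [TLTerm.mat, _root_.add_assoc]
  | add_comm f g => simp [TLTerm.mat, _root_.add_comm]
  | zero_add f => simp [TLTerm.mat]
  | smul_add a f g => simp [TLTerm.mat]
  | add_smul a b f => simp [TLTerm.mat, _root_.add_smul]
  | mul_smul a b f => simp [TLTerm.mat, smul_smul]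
  | one_smul f => simp [TLTerm.mat]
  | zero_smul f => simp [TLTerm.mat]
  | add_comp f f' g => simp [TLTerm.mat, Matrix.add_mul]
  | comp_add f g g' => simp [TLTerm.mat, Matrix.mul_add]
  | smul_comp a f g => simp [TLTerm.mat]
  | comp_smul a f g => simp [TLTerm.mat]
  | add_tensor f f' g => ext u v; simp [TLTerm.mat, add_mul]
  | tensor_add f g g' => ext u v; simp [TLTerm.mat, mul_add]
  | smul_tensor a f g => ext u v; simp [TLTerm.mat, mul_assoc]
  | tensor_smul a f g => ext u v; simp [TLTerm.mat, mul_left_comm]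
  | tensor_id m n =>
    ext u v
    simp only [TLTerm.mat, Matrix.of_apply, Matrix.one_apply]
    by_cases h : u = v
    · simp [h]
    · rw [if_neg h, mul_ite_zero, mul_one, ← ite_and, if_neg]
      rintro ⟨h1, h2⟩
      exact h (funext fun i => Fin.addCases (fun i => congrFun h2 i) (fun i => congrFun h1 i) i)
  | @tensor_comp l m n l' m' n' f g f' g' =>
    ext u v
    simp only [TLTerm.mat, Matrix.of_apply, Matrix.mul_apply]
    rw [← (Fin.appendEquiv m m').sum_comp, Fintype.sum_prod_type, Finset.sum_mul_sum]
    refine Finset.sum_congr rfl fun a _ => Finset.sum_congr rfl fun b _ => ?_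
    simp [Fin.appendEquiv]
    ring
  | tensor_assoc f g h =>
    ext u v
    rw [TLTerm.mat_comp_ofEq, TLTerm.mat_ofEq_comp]
    simp only [TLTerm.mat, Matrix.of_apply, mul_assoc]
    congr 1
    congr 2 <;> ext i <;> congr 1 <;> ext <;> simp [Nat.add_assoc]
  | zero_tensor f =>
    ext u v
    rw [TLTerm.mat_comp_ofEq, TLTerm.mat_ofEq_comp]
    simp only [TLTerm.mat, Matrix.of_apply, Matrix.one_apply]
    rw [if_pos (Subsingleton.elim _ _), one_mul]
    congr 1 <;> ext i <;> congr 1 <;> ext <;> simp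
  | tensor_zero f =>
    ext u v
    simp only [TLTerm.mat, Matrix.of_apply, Matrix.one_apply]
    rw [if_pos (Subsingleton.elim _ _), mul_one]
    rfl
  | zigzag_left =>
    ext u v
    simp only [TLTerm.mat, Matrix.of_apply, Matrix.mul_apply, Matrix.zero_apply]
    refine Finset.sum_eq_zero fun w _ => ?_
    by_cases h : w 1 = true
    · rw [if_neg (fun h' => by simpa [h] using h'.2.symm.trans h), zero_mul, zero_mul]
    · rw [mul_comm, if_neg (fun h' => h h'.1), mul_zero, zero_mul]
  | zigzag_right =>
    ext u v
    simp only [TLTerm.mat, Matrix.of_apply, Matrix.mul_apply, Matrix.zero_apply]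
    refine Finset.sum_eq_zero fun w _ => ?_
    by_cases h : w 1 = true
    · rw [mul_comm, if_neg (fun h' => by simpa [h] using h'.2.symm.trans h), zero_mul, zero_mul]
    · rw [if_neg (fun h' => h h'.1), mul_zero, zero_mul]
  | circle =>
    ext u v
    simp only [TLTerm.mat, Matrix.of_apply, Matrix.mul_apply]
    rw [Subsingleton.elim u v, Matrix.one_apply_eq, Finset.sum_eq_single ![true, false]]
    · simp
    · intro w _ hw
      rw [if_neg, zero_mul]
      rintro ⟨h0, h1⟩
      exact hw (by ext i; fin_cases i <;> simp [h0, h1])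
    · simp

/-- The matrix of a morphism of `TL₀(k)`. -/
noncomputable def TL0.homMat {k : Type u} [Field k] {X Y : TL0 k} :
    (X ⟶ Y) → Matrix (Fin X.strands → Bool) (Fin Y.strands → Bool) k :=
  Quot.lift TLTerm.mat (fun _ _ h => h.mat_eq)

section
variable {k : Type u} [Field k] {m n m' n' : ℕ}

theorem TLRel.assoc_one (f : TLTerm k m n) (g : TLTerm k m' n') :
    TLRel k ((f.tensor g).tensor (.id 1)) (f.tensor (g.tensor (.id 1))) :=
  .trans (.symm (.comp_id _)) (.trans (.tensor_assoc f g (.id 1)) (.id_comp _))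

theorem TLRel.id_id_cap (m n : ℕ) : TLRel k
    ((TLTerm.id m).tensor ((TLTerm.id n).tensor .cap)) ((TLTerm.id (m + n)).tensor .cap) :=
  .symm (.trans (.tensor_congr (.symm (.tensor_id m n)) (.refl _)) (.trans (.symm (.comp_id _))
    (.trans (.tensor_assoc (.id m) (.id n) .cap) (.id_comp _))))

theorem TLRel.slide_cap (g : TLTerm k m n) : TLRel k
    (((g.tensor (.id 1)).tensor (.id 1)).comp ((TLTerm.id n).tensor .cap))
    (((TLTerm.id m).tensor .cap).comp g) :=
  .trans (.comp_congr (.trans (.assoc_one g (.id 1)) (.tensor_congr (.refl g) (.tensor_id 1 1)))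
      (.refl _))
    (.trans (.symm (.tensor_comp g (.id n) (.id 2) .cap))
      (.trans (.tensor_congr (.trans (.comp_id g) (.symm (.id_comp g)))
          (.trans (.id_comp _) (.symm (.comp_id _))))
        (.trans (.tensor_comp (.id m) g .cap (.id 0))
          (.comp_congr (.refl _) (.tensor_zero g)))))

end

namespace CapDiagramTo

/-- The word recording which strands of a cap diagram are right ends of caps. -/
def word : {n t : ℕ} → CapDiagramTo n t → Fin n → Bool
  | _, _, .nil => Fin.elim0
  | _, _, .through x => Fin.snoc (α := fun _ => Bool) x.word true
  | _, _, .close x => Fin.snoc (α := fun _ => Bool) x.word false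

variable (k : Type u) [Field k]

theorem homMat_through {n t : ℕ} (x : CapDiagramTo n t) (u : Fin (n + 1) → Bool)
    (v : Fin (t + 1) → Bool) : TL0.homMat (x.through.toHom k) u v =
      TL0.homMat (x.toHom k) (fun i => u i.castSucc) (fun i => v i.castSucc) *
        if u (Fin.last n) = v (Fin.last t) then 1 else 0 := by
  have h : TL0.homMat (x.through.toHom k) u v =
      TL0.homMat (x.toHom k) (fun i => u i.castSucc) (fun i => v i.castSucc) *
        (1 : Matrix (Fin 1 → Bool) (Fin 1 → Bool) k) (fun i => u (i.natAdd n))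
          (fun i => v (i.natAdd t)) := by
    simp only [toHom]
    obtain ⟨f, hf⟩ := TL0.mk_surj (k := k) (x.toHom k)
    rw [← hf]
    rfl
  rw [h, Matrix.one_apply]
  congr 1
  refine if_congr ⟨fun h => congrFun h 0, fun h => funext fun i => ?_⟩ rfl rfl
  rw [Subsingleton.elim i 0]
  exact h

theorem homMat_close {n t : ℕ} (x : CapDiagramTo n (t + 1)) (u : Fin (n + 1) → Bool)
    (v : Fin t → Bool) : TL0.homMat (x.close.toHom k) u v =
      TL0.homMat (x.toHom k) (fun i => u i.castSucc) (Fin.snoc (α := fun _ => Bool) v true) *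
        if u (Fin.last n) = false then 1 else 0 := by
  have h : TL0.homMat (x.close.toHom k) u v =
      ∑ w : Fin (t + 2) → Bool, TL0.homMat (x.through.toHom k) u w *
        ((1 : Matrix (Fin t → Bool) (Fin t → Bool) k) (fun i => w (i.castAdd 2)) v *
          if w (Fin.natAdd t 0) = true ∧ w (Fin.natAdd t 1) = false then 1 else 0) := by
    simp only [toHom]
    obtain ⟨f, hf⟩ := TL0.mk_surj (k := k) (x.toHom k)
    rw [← hf]
    rfl
  rw [h, Finset.sum_eq_single (Fin.snoc (α := fun _ => Bool)
    (Fin.snoc (α := fun _ => Bool) v true : Fin (t + 1) → Bool) false : Fin (t + 2) → Bool)]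
  · have h0 : (Fin.natAdd t 0 : Fin (t + 2)) = (Fin.last t).castSucc := rfl
    have h1 : (Fin.natAdd t 1 : Fin (t + 2)) = Fin.last (t + 1) := rfl
    have h2 (i : Fin t) : (Fin.castAdd 2 i : Fin (t + 2)) = i.castSucc.castSucc := rfl
    rw [homMat_through]
    have h3 : (fun i : Fin t => (Fin.snoc (α := fun _ => Bool) (Fin.snoc (α := fun _ => Bool) v true :
        Fin (t + 1) → Bool) false : Fin (t + 2) → Bool) (i.castAdd 2)) = v := by
      funext i
      rw [h2]
      simp
    rw [h3]
    simp [h0, h1]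
  · intro w _ hw
    by_cases h1 : (fun i => w (i.castAdd 2)) = v
    · rw [if_neg, mul_zero, mul_zero]
      rintro ⟨h2, h3⟩
      refine hw (funext fun i => ?_)
      refine Fin.lastCases ?_ (fun i => ?_) i
      · simp only [Fin.snoc_last]; exact h3
      · refine Fin.lastCases ?_ (fun i => ?_) i
        · simp only [Fin.snoc_castSucc, Fin.snoc_last]; exact h2
        · simp only [Fin.snoc_castSucc]; exact congrFun h1 i
    · rw [Matrix.one_apply, if_neg h1, zero_mul, mul_zero]
  · simp

theorem homMat_word {n t : ℕ} (x y : CapDiagramTo n t) :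
    TL0.homMat (y.toHom k) x.word (fun _ => true) = 1 ∧ x = y ∨
      TL0.homMat (y.toHom k) x.word (fun _ => true) = 0 ∧ x ≠ y := by
  induction x with
  | nil =>
    cases y
    rw [Subsingleton.elim (word .nil) (fun _ => true)]
    exact .inl ⟨Matrix.one_apply_eq _, rfl⟩
  | through x ih =>
    cases y with
    | through y =>
      rw [homMat_through]
      simpa [word] using ih y
    | close y =>
      rw [homMat_close]
      simp [word]
  | @close n t x ih =>
    cases y with
    | through y =>
      rw [homMat_through]
      simp [word]
    | close y =>
      rw [homMat_close]
      have : (Fin.snoc (α := fun _ => Bool) (fun _ : Fin t => true) true : Fin (t + 1) → Bool) =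
          fun _ => true := by
        ext i; refine Fin.lastCases ?_ (fun i => ?_) i <;> simp
      rw [this]
      simpa [word] using ih y

theorem toHom_injective {n t : ℕ} :
    Function.Injective (toHom k : CapDiagramTo n t → _) := by
  intro x y h
  rcases homMat_word k x y with ⟨_, h1⟩ | ⟨h0, _⟩
  · exact h1
  · rcases homMat_word k x x with ⟨h1, _⟩ | ⟨_, h2⟩
    · rw [← h, h1] at h0
      exact absurd h0 one_ne_zero
    · exact absurd rfl h2

theorem toHom_ne_zero {n t : ℕ} (x : CapDiagramTo n t) : x.toHom k ≠ 0 := by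
  intro h
  rcases homMat_word k x x with ⟨h1, _⟩ | ⟨_, h2⟩
  · rw [h] at h1
    exact zero_ne_one h1
  · exact h2 rfl

variable {k}

theorem isCapGenerated_toHom {n t : ℕ} (x : CapDiagramTo n t) :
    TL0.IsCapGenerated (x.toHom k) := by
  induction x with
  | nil => exact .id _
  | through x ih =>
    simp only [toHom, ← tensorHom_id]
    exact .tensor ih (.id _)
  | close x ih =>
    simp only [toHom, ← tensorHom_id, ← id_tensorHom]
    exact .comp (.tensor ih (.id _)) (.tensor (.id _) .cap)

theorem exists_toHom_id (n : ℕ) : ∃ x : CapDiagramTo n n, x.toHom k = 𝟙 _ := by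
  induction n with
  | zero => exact ⟨.nil, rfl⟩
  | succ n ih =>
    obtain ⟨x, hx⟩ := ih
    refine ⟨x.through, ?_⟩
    simp only [toHom, hx]
    exact id_whiskerRight _ _

theorem exists_toHom_comp {l m n : ℕ} (x : CapDiagramTo l m) (y : CapDiagramTo m n) :
    ∃ z : CapDiagramTo l n, z.toHom k = x.toHom k ≫ y.toHom k := by
  induction x generalizing n with
  | nil =>
    refine ⟨y, (Category.id_comp _).symm⟩
  | through x ih =>
    cases y with
    | through y =>
      obtain ⟨z, hz⟩ := ih y
      refine ⟨z.through, ?_⟩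
      simp only [toHom, hz]
      exact comp_whiskerRight _ _ _
    | close y =>
      obtain ⟨z, hz⟩ := ih y
      refine ⟨z.close, ?_⟩
      simp only [toHom, hz]
      exact (congrArg (· ≫ _) (comp_whiskerRight _ _ _)).trans (Category.assoc _ _ _)
  | close x ih =>
    obtain ⟨z, hz⟩ := ih y.through
    refine ⟨z.close, ?_⟩
    simp only [toHom] at hz ⊢
    rw [hz]
    obtain ⟨f, hf⟩ := TL0.mk_surj (k := k) (x.toHom k)
    obtain ⟨g, hg⟩ := TL0.mk_surj (k := k) (y.toHom k)
    rw [← hf, ← hg]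
    refine TL0.mk_eq (.trans (.comp_congr (.trans (.tensor_congr (.refl _)
      (.symm (.comp_id (.id 1)))) (.tensor_comp f (g.tensor (.id 1)) (.id 1) (.id 1))) (.refl _))
      (.trans (.comp_assoc _ _ _) (.trans (.comp_congr (.refl _) ?_) (.symm (.comp_assoc _ _ _)))))
    exact TLRel.slide_cap g

theorem exists_toHom_tensor {m n s t : ℕ} (x : CapDiagramTo m s) (y : CapDiagramTo n t) :
    ∃ z : CapDiagramTo (m + n) (s + t), z.toHom k = (x.toHom k ⊗ₘ y.toHom k) := by
  induction y with
  | nil =>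
    refine ⟨x, ?_⟩
    obtain ⟨f, hf⟩ := TL0.mk_surj (k := k) (x.toHom k)
    simp only [toHom]
    rw [← hf]
    exact (TL0.mk_eq (.tensor_zero f)).symm
  | through y ih =>
    obtain ⟨z, hz⟩ := ih
    refine ⟨z.through, ?_⟩
    simp only [toHom, hz]
    obtain ⟨f, hf⟩ := TL0.mk_surj (k := k) (x.toHom k)
    obtain ⟨g, hg⟩ := TL0.mk_surj (k := k) (y.toHom k)
    rw [← hf, ← hg]
    exact TL0.mk_eq (TLRel.assoc_one f g)
  | close y ih =>
    obtain ⟨z, hz⟩ := ih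
    refine ⟨z.close, ?_⟩
    simp only [toHom, hz]
    obtain ⟨f, hf⟩ := TL0.mk_surj (k := k) (x.toHom k)
    obtain ⟨g, hg⟩ := TL0.mk_surj (k := k) (y.toHom k)
    rw [← hf, ← hg]
    exact TL0.mk_eq (.symm (.trans (.tensor_congr (.symm (.comp_id f)) (.refl _))
      (.trans (.tensor_comp _ _ _ _) (.comp_congr (.symm (TLRel.assoc_one f g))
      (TLRel.id_id_cap _ _)))))

theorem exists_toHom {X Y : TL0 k} (f : X ⟶ Y) (hf : TL0.IsCapGenerated f) :
    ∃ x : CapDiagramTo X.strands Y.strands, x.toHom k = f := by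
  induction hf with
  | id X => exact exists_toHom_id X.strands
  | cap =>
    refine ⟨.close (.through .nil), ?_⟩
    have h : TLRel k ((((TLTerm.id 0).tensor (.id 1)).tensor (.id 1)).comp
        ((TLTerm.id 0).tensor .cap) : TLTerm k 2 0) TLTerm.cap :=
      .trans (.comp_congr (.trans (.tensor_congr (.tensor_id 0 1) (.refl _)) (.tensor_id 1 1))
        (.trans (.symm (.comp_id _)) (.trans (.zero_tensor TLTerm.cap) (.id_comp _)))) (.id_comp _)
    exact TL0.mk_eq h
  | tensor _ _ ih ih' =>
    obtain ⟨x, hx⟩ := ih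
    obtain ⟨y, hy⟩ := ih'
    rw [← hx, ← hy]
    exact exists_toHom_tensor x y
  | comp _ _ ih ih' =>
    obtain ⟨x, hx⟩ := ih
    obtain ⟨y, hy⟩ := ih'
    rw [← hx, ← hy]
    exact exists_toHom_comp x y

/-- Cap diagrams are the same as non-zero morphisms of `TL₀(k)` obtained from `cap` and identities by
tensor product and composition. -/
theorem bijOn_toHom (n t : ℕ) : Set.BijOn (toHom k : CapDiagramTo n t → _) Set.univ
    {f | TL0.IsCapGenerated f ∧ f ≠ 0} :=
  ⟨fun x _ => ⟨isCapGenerated_toHom x, toHom_ne_zero k x⟩, (toHom_injective k).injOn,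
    fun f hf => let ⟨x, hx⟩ := exists_toHom f hf.1; ⟨x, trivial, hx⟩⟩

end CapDiagramTo

/-! ### Operations on cap diagrams -/

/-- The set `𝒟ₙ` of all cap diagrams with `n` strands at the bottom. -/
abbrev CapDiagram (n : ℕ) : Type := Σ t : ℕ, CapDiagramTo n t

namespace CapDiagram

/-- The number of through-strands. -/
def th {n : ℕ} (x : CapDiagram n) : ℕ := x.1

/-- The morphism `n → th(x)` of `TL₀(k)` depicted by a cap diagram `x`. -/
def toHom (k : Type u) [Field k] {n : ℕ} (x : CapDiagram n) :
    (TL0.obj n : TL0 k) ⟶ TL0.obj x.th := x.2.toHom k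

/-- Add a through-strand on the right. -/
def addThrough {n : ℕ} (x : CapDiagram n) : CapDiagram (n + 1) := ⟨_, x.2.through⟩

/-- Add a strand on the right and join it by a cap with the rightmost through-strand. (If there is
no through-strand to join it with, it is added as a through-strand; this case never occurs below.) -/
def addClose {n : ℕ} : CapDiagram n → CapDiagram (n + 1)
  | ⟨0, x⟩ => ⟨1, x.through⟩
  | ⟨_ + 1, x⟩ => ⟨_, x.close⟩

/-- Delete the last strand; the strand it was capped with, if any, becomes a through-strand. -/
def dropLast {n : ℕ} : CapDiagram (n + 1) → CapDiagram n
  | ⟨_, .through x⟩ => ⟨_, x⟩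
  | ⟨_, .close x⟩ => ⟨_, x⟩

instance instFinite (n : ℕ) : Finite (CapDiagram n) := by
  induction n with
  | zero =>
    have : Subsingleton (CapDiagram 0) := ⟨by rintro ⟨_, ⟨⟩⟩ ⟨_, ⟨⟩⟩; rfl⟩
    infer_instance
  | succ n ih =>
    refine Finite.of_surjective
      (fun p : CapDiagram n × Bool => if p.2 then addThrough p.1 else addClose p.1) ?_
    rintro ⟨_, x | x⟩
    · exact ⟨(⟨_, by assumption⟩, true), rfl⟩
    · exact ⟨(⟨_, by assumption⟩, false), rfl⟩

noncomputable instance (n : ℕ) : Fintype (CapDiagram n) := Fintype.ofFinite _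

/-- The positions (in `{1, …, n}`) of the through-strands, listed from right to left. -/
def throughs : {n t : ℕ} → CapDiagramTo n t → List ℕ
  | _, _, .nil => []
  | n + 1, _, .through x => (n + 1) :: throughs x
  | _, _, .close x => (throughs x).tail

/-- `x_{≤ m}`: delete the last `n` strands, turning the remaining half-caps into through-strands. -/
def le (m : ℕ) : (n : ℕ) → CapDiagram (m + n) → CapDiagram m
  | 0, x => x
  | n + 1, x => le m n (dropLast x)

/-- `x_{> m}`: delete the first `m` strands, turning the remaining half-caps into through-strands.
Reading `x` from left to right: if a strand is capped with the strand at position `i`, then it is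
still capped if `m < i`, and becomes a through-strand otherwise. -/
def gt (m : ℕ) : (n : ℕ) → CapDiagram (m + n) → CapDiagram n
  | 0, _ => ⟨0, .nil⟩
  | n + 1, ⟨_, .through x⟩ => addThrough (gt m n ⟨_, x⟩)
  | n + 1, ⟨_, .close x⟩ =>
    if ∃ i ∈ (throughs x).head?, m < i then addClose (gt m n ⟨_, x⟩)
    else addThrough (gt m n ⟨_, x⟩)

/-- The number `hk_m(x)`: the `l` such that `th(x) + 2 l = th(x_{≤ m}) + th(x_{> m})`. -/
def hk (m n : ℕ) (x : CapDiagram (m + n)) : ℕ := ((le m n x).th + (gt m n x).th - x.th) / 2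

/-- The concatenation (tensor product) of two cap diagrams. -/
def concat {m : ℕ} (y : CapDiagram m) : {n : ℕ} → CapDiagram n → CapDiagram (m + n)
  | _, ⟨_, .nil⟩ => y
  | _, ⟨_, .through z⟩ => addThrough (concat y ⟨_, z⟩)
  | _, ⟨_, .close z⟩ => addClose (concat y ⟨_, z⟩)

/-- Counting through-strands from the left as `0, 1, 2, …`, join the through-strands number `a` and
`a + 1` by a cap. (Meaningful if there are at least `a + 2` through-strands.) -/
def join (a : ℕ) : {n t : ℕ} → CapDiagramTo n t → CapDiagram n
  | _, _, .nil => ⟨0, .nil⟩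
  | _, t + 1, .through x => if t = a + 1 then addClose ⟨_, x⟩ else addThrough (join a x)
  | _, _, .close x => addClose (join a x)

/-- The `l`-hooking `y ⊙_l z`: concatenate `y` and `z` and then, `l` times, join the rightmost
remaining through-strand of `y` and the leftmost remaining through-strand of `z` by a cap.
(Meaningful if `l ≤ min (th y) (th z)`.) -/
def hooking {m n : ℕ} (y : CapDiagram m) (z : CapDiagram n) : ℕ → CapDiagram (m + n)
  | 0 => concat y z
  | l + 1 => join (y.th - (l + 1)) (hooking y z l).2

/-- The map `κ_{m,n}` from cap diagrams on `m + n` strands to cap diagrams on `n + m` strands,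
`x ↦ x_{> m} ⊙_{hk_m(x)} x_{≤ m}`. -/
def kappa (m n : ℕ) (x : CapDiagram (m + n)) : CapDiagram (n + m) :=
  hooking (gt m n x) (le m n x) (hk m n x)

/-! The map `κ` preserves the number of through-strands. -/

theorem length_throughs {n t : ℕ} (x : CapDiagramTo n t) : (throughs x).length = t := by
  induction x with
  | nil => rfl
  | through x ih => simp [throughs, ih]
  | close x ih => simp [throughs, ih]

theorem throughs_le {n t : ℕ} (x : CapDiagramTo n t) : ∀ i ∈ throughs x, i ≤ n := by
  induction x with
  | nil => simp [throughs]
  | through x ih =>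
    intro i hi
    rcases List.mem_cons.1 hi with rfl | hi
    · exact le_rfl
    · exact (ih i hi).trans (Nat.le_succ _)
  | close x ih => exact fun i hi => (ih i (List.mem_of_mem_tail hi)).trans (Nat.le_succ _)

theorem pairwise_throughs {n t : ℕ} (x : CapDiagramTo n t) :
    (throughs x).Pairwise (fun i j => j < i) := by
  induction x with
  | nil => simp [throughs]
  | through x ih =>
    exact List.pairwise_cons.2 ⟨fun i hi => Nat.lt_succ_of_le (throughs_le x i hi), ih⟩
  | close x ih => exact ih.tail

theorem th_addThrough {n : ℕ} (x : CapDiagram n) : (addThrough x).th = x.th + 1 := rfl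

theorem th_addClose {n : ℕ} (x : CapDiagram n) (h : 0 < x.th) :
    (addClose x).th = x.th - 1 := by
  obtain ⟨_ | t, x⟩ := x
  · exact absurd h (lt_irrefl 0)
  · rfl

theorem th_le_gt (m n : ℕ) {t : ℕ} (x : CapDiagramTo (m + n) t) :
    ∃ h : ℕ, (le m n ⟨t, x⟩).th = (throughs x).countP (· ≤ m) + h ∧
      (gt m n ⟨t, x⟩).th = (throughs x).countP (m < ·) + h := by
  induction n generalizing t with
  | zero =>
    have hx := throughs_le x
    have h1 : (throughs x).countP (· ≤ m) = (throughs x).length :=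
      List.countP_eq_length.2 (by simpa using hx)
    have h2 : (throughs x).countP (m < ·) = 0 :=
      List.countP_eq_zero.2 (by simpa using hx)
    refine ⟨0, ?_, ?_⟩
    · rw [h1, length_throughs]; rfl
    · rw [h2]; rfl
  | succ n ih =>
    match t, x with
    | _, .through x =>
      obtain ⟨h, h1, h2⟩ := ih x
      refine ⟨h, ?_, ?_⟩
      · simp only [le, dropLast, h1, throughs, List.countP_cons]
        simp
      · simp only [gt, th_addThrough, h2, throughs, List.countP_cons]
        simp; omega
    | t, .close x =>
      obtain ⟨h, h1, h2⟩ := ih x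
      have hl := length_throughs x
      have hp := pairwise_throughs x
      simp only [le, dropLast, gt, throughs]
      revert h1 h2 hl hp
      generalize throughs x = L
      rcases L with _ | ⟨a, L⟩
      · simp
      intro h1 h2 _ hp
      simp only [List.countP_cons] at h1 h2
      by_cases ha : m < a
      · refine ⟨h, ?_, ?_⟩
        · simp [not_le.2 ha] at h1 ⊢; exact h1
        · simp [ha] at h2 ⊢
          rw [th_addClose _ (by omega)]; omega
      · have h3 : L.countP (m < ·) = 0 := by
          rw [List.countP_eq_zero]
          intro i hi
          have := (List.pairwise_cons.1 hp).1 i hi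
          simp; omega
        refine ⟨h + 1, ?_, ?_⟩
        · simp [not_lt.1 ha] at h1 ⊢; omega
        · simp [ha, th_addThrough, h3] at h2 ⊢; omega

theorem th_concat {m n t : ℕ} (y : CapDiagram m) (z : CapDiagramTo n t) :
    (concat y ⟨t, z⟩).th = y.th + t := by
  induction z with
  | nil => rfl
  | through z ih => simp only [concat, th_addThrough, ih]; omega
  | close z ih =>
    simp only [concat]
    rw [th_addClose _ (by omega), ih]; omega

theorem th_join (a : ℕ) {n t : ℕ} (x : CapDiagramTo n t) (h : a + 2 ≤ t) :
    (join a x).th = t - 2 := by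
  induction x with
  | nil => omega
  | @through n t x ih =>
    simp only [join]
    split_ifs with hta
    · rw [th_addClose _ (by simp only [th]; omega)]; simp only [th]; omega
    · rw [th_addThrough, ih (by omega)]; omega
  | close x ih =>
    simp only [join]
    have := ih (by omega)
    rw [th_addClose _ (by omega), this]; omega

theorem th_hooking {m n : ℕ} (y : CapDiagram m) (z : CapDiagram n) (l : ℕ) (hy : l ≤ y.th)
    (hz : l ≤ z.th) : (hooking y z l).th = y.th + z.th - 2 * l := by
  induction l with
  | zero => exact th_concat y z.2
  | succ l ih =>
    have ih := ih (by omega) (by omega)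
    simp only [hooking]
    rw [th_join _ _ (by change _ ≤ (hooking y z l).th; omega)]
    change (hooking y z l).th - 2 = _
    omega

theorem th_kappa (m n : ℕ) (x : CapDiagram (m + n)) : (kappa m n x).th = x.th := by
  obtain ⟨t, x⟩ := x
  obtain ⟨h, h1, h2⟩ := th_le_gt m n x
  have h3 := length_throughs x
  have h4 : (throughs x).length = (throughs x).countP (· ≤ m) + (throughs x).countP (m < ·) := by
    simpa using List.length_eq_countP_add_countP (fun i => decide (i ≤ m)) (l := throughs x)
  have h5 : hk m n ⟨t, x⟩ = h := by simp only [hk, h1, h2]; simp only [th]; omega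
  rw [kappa, h5, th_hooking _ _ _ (by omega) (by omega), h1, h2]
  simp only [th]; omega

end CapDiagram

/-! ### Jones–Wenzl projectors -/

/-- The cap diagram on `n` strands with caps in positions `(i, i + 1)` for `i ∈ I`, where `I` is a
subset of `{1, …, n - 1}` without two consecutive elements. -/
def capSet (I : Finset ℕ) : (n : ℕ) → CapDiagram n
  | 0 => ⟨0, .nil⟩
  | n + 1 => if n ∈ I then (capSet I n).addClose else (capSet I n).addThrough

/-- Apt subsets `I` of `{1, …, n}`: `n ∉ I`, and `i ∈ I` implies `i - 1, i + 1 ∉ I`. -/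
def aptSubsets (n : ℕ) : Finset (Finset ℕ) :=
  (Finset.Icc 1 n).powerset.filter fun I => n ∉ I ∧ ∀ i ∈ I, i - 1 ∉ I ∧ i + 1 ∉ I

/-- The Jones–Wenzl projector `j_n = ∑_I (-1)^|I| cup_I ∘ cap_I`, the sum over apt `I`. -/
noncomputable def jonesWenzl (k : Type u) [Field k] (n : ℕ) : (TL0.obj n : TL0 k) ⟶ TL0.obj n :=
  ∑ I ∈ aptSubsets n,
    (-1 : k) ^ I.card • ((capSet I n).toHom k ≫ TL0.bar ((capSet I n).toHom k))

/-! ### The commutor -/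

/-- `τ_{m,n}(x) = \overline{κ_{m,n}(x)} ∘ j_{th(x)} ∘ x`. The `eqToHom` is the identity of `th(x)`,
viewed as a morphism `th(x) → th(κ_{m,n}(x))`. -/
noncomputable def commutorTerm (k : Type u) [Field k] (m n : ℕ) (x : CapDiagram (m + n)) :
    (TL0.obj m ⊗ TL0.obj n : TL0 k) ⟶ TL0.obj n ⊗ TL0.obj m :=
  x.toHom k ≫ jonesWenzl k x.th ≫
    eqToHom (congrArg TL0.obj (CapDiagram.th_kappa m n x).symm) ≫
      TL0.bar ((CapDiagram.kappa m n x).toHom k)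

/-- `σ_{m,n} = ∑_{x ∈ 𝒟_{m+n}} \overline{κ_{m,n}(x)} ∘ j_{th(x)} ∘ x : m ⊗ n → n ⊗ m`. -/
noncomputable def commutor (k : Type u) [Field k] (m n : ℕ) :
    (TL0.obj m ⊗ TL0.obj n : TL0 k) ⟶ TL0.obj n ⊗ TL0.obj m :=
  ∑ x : CapDiagram (m + n), commutorTerm k m n x

/-- A coboundary structure on a monoidal category: a natural isomorphism `σ_{A,B} : A ⊗ B → B ⊗ A`
satisfying the symmetry, unit and cactus axioms. -/
structure CoboundaryStructure (C : Type*) [Category C] [MonoidalCategory C] where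
  /-- The commutor. -/
  σ (A B : C) : A ⊗ B ≅ B ⊗ A
  naturality {A A' B B' : C} (f : A ⟶ A') (g : B ⟶ B') :
    (f ⊗ₘ g) ≫ (σ A' B').hom = (σ A B).hom ≫ (g ⊗ₘ f)
  symmetry (A B : C) : (σ A B).hom ≫ (σ B A).hom = 𝟙 (A ⊗ B)
  unit (A : C) : (σ (𝟙_ C) A).hom = (λ_ A).hom ≫ (ρ_ A).inv
  cactus (A B D : C) :
    A ◁ (σ B D).hom ≫ (σ A (D ⊗ B)).hom =
      (α_ A B D).inv ≫ (σ A B).hom ▷ D ≫ (σ (B ⊗ A) D).hom ≫ (α_ D B A).inv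

/-!
The proof transports everything to bracket words. In the matrix representation `TL0.homMat`, rows
and columns are indexed by words in opening and closing brackets, and a word is the same thing as
the cap diagram `diag u` of its matching brackets together with the number `low u` of its
unmatched closing brackets (`Word.fill_diag`, `Word.ext_diag`). A cap diagram acts by deleting
matching brackets (`CapDiagramTo.homMat_toHom`), and `j_n` projects onto the words without
matching brackets (`homMat_jonesWenzl`), so the morphisms `\overline{y} ∘ j ∘ x` act as partial
bijections that replace the cap diagram `x` by `y` and keep the unmatched brackets
(`homMat_unit`). Hence the commutor acts on words by applying `κ` to the cap diagram and keeping
the number of unmatched closing brackets.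

Let `evac` be the involution of words which keeps the cap diagram and exchanges the numbers of
unmatched opening and closing brackets. Counting the brackets matched between the two parts of a
word shows that `κ` is the effect on cap diagrams of `u v ↦ evac v * evac u`
(`Word.diag_exchange`), and therefore the commutor acts by `u v ↦ evac (evac v * evac u)`
(`Word.comm`, `homMat_commutor`). For this formula the symmetry, unit and cactus axioms are
immediate: in the cactus axiom both sides send `u v w` to `evac (evac w * evac v * evac u)`.
Naturality follows since all morphisms commute with `evac` (`TL0.homMat_evac`): the identity is
the sum of the `\overline{x} ∘ j ∘ x`, so every cap diagram is a sum of morphisms `\overline{y} ∘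
j ∘ x`, and those commute with `evac`.

It remains to know that the matrix representation is faithful (`TL0.homMat_injective`). The
composites of a cap diagram with the reflection of a cap diagram span all morphism spaces, because
the opposite composites reduce by the circle and zig-zag relations (`TL0.bar_toHom_comp_toHom`),
and their matrices are linearly independent by a triangularity argument
(`TL0.linearIndependent_homMat_glue`).
-/

/-! ### Bracket words -/

/-- Words of length `n` in the letters `true` (an opening bracket) and `false` (a closing bracket).
They index the rows and columns of the matrices of morphisms of `TL₀(k)`. -/
abbrev Word (n : ℕ) : Type := Fin n → Bool

namespace Word

/-- Add a letter on the right. -/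
def snoc {n : ℕ} (u : Word n) (b : Bool) : Word (n + 1) := Fin.snoc (α := fun _ => Bool) u b

@[simp] theorem snoc_castSucc {n : ℕ} (u : Word n) (b : Bool) (i : Fin n) :
    snoc u b i.castSucc = u i := Fin.snoc_castSucc (α := fun _ => Bool) ..

@[simp] theorem snoc_last {n : ℕ} (u : Word n) (b : Bool) : snoc u b (Fin.last n) = b :=
  Fin.snoc_last (α := fun _ => Bool) ..

@[simp] theorem init_snoc {n : ℕ} (u : Word n) (b : Bool) :
    Fin.init (α := fun _ => Bool) (snoc u b) = u := Fin.init_snoc (α := fun _ => Bool) ..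

theorem exists_snoc {n : ℕ} (u : Word (n + 1)) : ∃ v b, u = snoc v b :=
  ⟨Fin.init u, u (Fin.last n), (Fin.snoc_init_self (α := fun _ => Bool) u).symm⟩

@[simp] theorem snoc_inj {n : ℕ} {u v : Word n} {b c : Bool} :
    snoc u b = snoc v c ↔ u = v ∧ b = c := by
  refine ⟨fun h => ⟨?_, ?_⟩, fun h => by rw [h.1, h.2]⟩
  · rw [← init_snoc u b, h, init_snoc]
  · rw [← snoc_last u b, h, snoc_last]

theorem append_snoc {m n : ℕ} (u : Word m) (v : Word n) (b : Bool) :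
    (Fin.append u (snoc v b) : Word (m + (n + 1))) = snoc (Fin.append u v : Word (m + n)) b :=
  Fin.append_snoc u v b

/-- The reduced word `false ^ a * true ^ (t - a)`. -/
def sorted (t a : ℕ) : Word t := fun i => decide (a ≤ i)

theorem sorted_succ (t a : ℕ) : sorted (t + 1) a = snoc (sorted t a) (decide (a ≤ t)) := by
  funext i
  refine Fin.lastCases ?_ (fun i => ?_) i <;> simp [sorted]

theorem sorted_congr {t a b : ℕ} (ha : t ≤ a) (hb : t ≤ b) : sorted t a = sorted t b := by
  funext i
  have := i.2
  simp only [sorted, decide_eq_decide]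
  omega

/-- Match brackets in a word: the first component is the cap diagram whose caps join the matching
brackets, the second one is the number of unmatched closing brackets. The unmatched closing brackets
precede the unmatched opening ones, and both give through-strands. -/
def parse : {n : ℕ} → Word n → CapDiagram n × ℕ
  | 0, _ => (⟨0, .nil⟩, 0)
  | n + 1, u =>
    let s := parse (Fin.init u : Word n)
    if u (Fin.last n) then (s.1.addThrough, s.2)
    else if s.2 < s.1.th then (s.1.addClose, s.2) else (s.1.addThrough, s.2 + 1)

/-- The cap diagram whose caps join the matching brackets of a word. -/
def diag {n : ℕ} (u : Word n) : CapDiagram n := (parse u).1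

/-- The number of unmatched closing brackets of a word. -/
def low {n : ℕ} (u : Word n) : ℕ := (parse u).2

@[simp] theorem diag_zero (u : Word 0) : diag u = ⟨0, .nil⟩ := rfl

@[simp] theorem low_zero (u : Word 0) : low u = 0 := rfl

section
variable {n : ℕ} (u : Word n)

@[simp] theorem diag_snoc_true : diag (snoc u true) = (diag u).addThrough := by
  simp [diag, parse]

@[simp] theorem low_snoc_true : low (snoc u true) = low u := by
  simp [low, parse]

variable {u}

theorem diag_snoc_false_of_lt (h : low u < (diag u).th) :
    diag (snoc u false) = (diag u).addClose := by
  simp only [low, diag] at h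
  simp [diag, parse, h]

theorem low_snoc_false_of_lt (h : low u < (diag u).th) : low (snoc u false) = low u := by
  simp only [low, diag] at h
  simp [low, parse, h]

theorem diag_snoc_false_of_le (h : (diag u).th ≤ low u) :
    diag (snoc u false) = (diag u).addThrough := by
  simp only [low, diag] at h
  simp [diag, parse, not_lt.2 h]

theorem low_snoc_false_of_le (h : (diag u).th ≤ low u) : low (snoc u false) = low u + 1 := by
  simp only [low, diag] at h
  simp [low, parse, not_lt.2 h]

end

theorem low_le {n : ℕ} (u : Word n) : low u ≤ (diag u).th := by
  induction n with
  | zero => simp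
  | succ n ih =>
    obtain ⟨u, b, rfl⟩ := exists_snoc u
    have := ih u
    cases b
    · rcases lt_or_ge (low u) (diag u).th with h | h
      · rw [low_snoc_false_of_lt h, diag_snoc_false_of_lt h, CapDiagram.th_addClose _ (by omega)]
        omega
      · rw [low_snoc_false_of_le h, diag_snoc_false_of_le h, CapDiagram.th_addThrough]
        omega
    · simp only [low_snoc_true, diag_snoc_true, CapDiagram.th_addThrough]
      omega

end Word

open Word

/-- Insert a word at the through-strands of a cap diagram, and a pair of matching brackets at the
ends of every cap. -/
def CapDiagramTo.fill : {n t : ℕ} → CapDiagramTo n t → Word t → Word n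
  | _, _, .nil, w => w
  | _, _, .through x, w => snoc (x.fill (Fin.init w)) (w (Fin.last _))
  | _, _, .close x, w => snoc (x.fill (snoc w true)) false

namespace CapDiagramTo

@[simp] theorem fill_through {n t : ℕ} (x : CapDiagramTo n t) (w : Word t) (b : Bool) :
    x.through.fill (snoc w b) = snoc (x.fill w) b := by
  simp [fill]

theorem fill_injective {n t : ℕ} (x : CapDiagramTo n t) : Function.Injective x.fill := by
  induction x with
  | nil => exact fun _ _ h => h
  | through x ih =>
    intro v w h
    obtain ⟨v, b, rfl⟩ := exists_snoc v
    obtain ⟨w, c, rfl⟩ := exists_snoc w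
    simp only [fill_through, snoc_inj] at h
    rw [ih h.1, h.2]
  | close x ih =>
    intro v w h
    simp only [fill, snoc_inj, and_true] at h
    exact (snoc_inj.1 (ih h)).1

theorem parse_fill_sorted {n t : ℕ} (x : CapDiagramTo n t) {a : ℕ} (ha : a ≤ t) :
    diag (x.fill (sorted t a)) = ⟨t, x⟩ ∧ low (x.fill (sorted t a)) = a := by
  induction x generalizing a with
  | nil => exact ⟨rfl, (Nat.le_zero.1 ha).symm⟩
  | @through n t x ih =>
    rw [sorted_succ, fill_through]
    rcases Nat.lt_or_ge t a with h | h
    · obtain rfl : a = t + 1 := by omega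
      have e : decide (t + 1 ≤ t) = false := by simp
      rw [sorted_congr (b := t) (by omega) le_rfl, e]
      obtain ⟨h1, h2⟩ := ih le_rfl
      rw [diag_snoc_false_of_le (by rw [h1, h2]; rfl), low_snoc_false_of_le (by rw [h1, h2]; rfl),
        h1, h2]
      exact ⟨rfl, rfl⟩
    · obtain ⟨h1, h2⟩ := ih h
      rw [decide_eq_true h, diag_snoc_true, low_snoc_true, h1, h2]
      exact ⟨rfl, rfl⟩
  | @close n t x ih =>
    have e : snoc (sorted t a) true = sorted (t + 1) a := by
      rw [sorted_succ, decide_eq_true ha]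
    obtain ⟨h1, h2⟩ := ih (a := a) (by omega)
    have h : low (x.fill (sorted (t + 1) a)) < (diag (x.fill (sorted (t + 1) a))).th := by
      rw [h1, h2]; exact Nat.lt_succ_of_le ha
    rw [fill, e, diag_snoc_false_of_lt h, low_snoc_false_of_lt h, h1, h2]
    exact ⟨rfl, rfl⟩

end CapDiagramTo

namespace Word

/-- Every word is recovered from its cap diagram and its reduced word. -/
theorem fill_diag {n : ℕ} (u : Word n) :
    (diag u).2.fill (sorted (diag u).th (low u)) = u := by
  induction n with
  | zero => exact Subsingleton.elim _ _
  | succ n ih =>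
    obtain ⟨u, b, rfl⟩ := exists_snoc u
    have h1 := ih u
    have h2 := low_le u
    cases b
    · rcases lt_or_ge (low u) (diag u).th with h | h
      · rw [low_snoc_false_of_lt h, diag_snoc_false_of_lt h]
        revert h1 h2 h
        generalize diag u = x
        obtain ⟨_ | t, x⟩ := x
        · intro _ _ h; exact absurd h (Nat.not_lt_zero _)
        · intro h1 h2 h
          have e : snoc (sorted t (low u)) true = sorted (t + 1) (low u) := by
            rw [sorted_succ, decide_eq_true (Nat.le_of_lt_succ h)]
          change x.close.fill (sorted t (low u)) = _
          rw [CapDiagramTo.fill, e]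
          exact congrArg (snoc · false) h1
      · rw [low_snoc_false_of_le h, diag_snoc_false_of_le h]
        revert h1 h2 h
        generalize diag u = x
        obtain ⟨t, x⟩ := x
        simp only [CapDiagram.th]
        intro h1 h2 h
        change x.through.fill (sorted (t + 1) _) = _
        rw [sorted_succ, CapDiagramTo.fill_through,
          sorted_congr (b := low u) (by omega) (by omega), h1, snoc_inj]
        simp; omega
    · rw [low_snoc_true, diag_snoc_true]
      revert h1 h2
      generalize diag u = x
      obtain ⟨t, x⟩ := x
      simp only [CapDiagram.th]
      intro h1 h2
      change x.through.fill (sorted (t + 1) _) = _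
      rw [sorted_succ, CapDiagramTo.fill_through, h1, decide_eq_true h2]

theorem ext_diag {n : ℕ} {u v : Word n} (h : diag u = diag v) (h' : low u = low v) : u = v := by
  rw [← fill_diag u, ← fill_diag v, h, h']

/-- The involution of words which keeps the matching brackets and exchanges the numbers of unmatched
opening and closing brackets (the Schützenberger–Lusztig involution of the crystal of words). -/
def evac {n : ℕ} (u : Word n) : Word n :=
  (diag u).2.fill (sorted (diag u).th ((diag u).th - low u))

@[simp] theorem diag_evac {n : ℕ} (u : Word n) : diag (evac u) = diag u :=
  ((diag u).2.parse_fill_sorted (Nat.sub_le _ _)).1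

@[simp] theorem low_evac {n : ℕ} (u : Word n) : low (evac u) = (diag u).th - low u :=
  ((diag u).2.parse_fill_sorted (Nat.sub_le _ _)).2

@[simp] theorem evac_evac {n : ℕ} (u : Word n) : evac (evac u) = u := by
  have := low_le u
  refine ext_diag (by simp) ?_
  simp only [low_evac, diag_evac]
  omega

/-! ### Cap diagrams of concatenated words -/

/-- The number of opening brackets of `u` closed by brackets of `v` in the concatenation `u v`. -/
def links {m n : ℕ} (u : Word m) (v : Word n) : ℕ := min ((diag u).th - low u) (low v)

/-- Every link between `u` and `v` uses up two through-strands, one of which carries a closing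
bracket. -/
theorem th_low_append {m n : ℕ} (u : Word m) (v : Word n) :
    (diag (Fin.append u v : Word (m + n))).th + 2 * links u v = (diag u).th + (diag v).th ∧
      low (Fin.append u v : Word (m + n)) + links u v = low u + low v := by
  induction n with
  | zero =>
    have e : (Fin.append u v : Word (m + 0)) = u := by
      rw [Subsingleton.elim v Fin.elim0, Fin.append_elim0]; rfl
    simp only [e, links, diag_zero, low_zero]
    exact ⟨by simp [CapDiagram.th], by simp⟩
  | succ n ih =>
    obtain ⟨v, b, rfl⟩ := exists_snoc v
    rw [append_snoc]
    have ih := ih v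
    have hu := low_le u
    have hv := low_le v
    revert ih
    generalize (Fin.append u v : Word (m + n)) = w
    rintro ⟨h1, h2⟩
    simp only [links] at *
    cases b
    · rcases lt_or_ge (low v) (diag v).th with h | h
      · have hw : low w < (diag w).th := by omega
        rw [low_snoc_false_of_lt h, diag_snoc_false_of_lt h, low_snoc_false_of_lt hw,
          diag_snoc_false_of_lt hw, CapDiagram.th_addClose _ (by omega),
          CapDiagram.th_addClose _ (by omega)]
        omega
      · rw [low_snoc_false_of_le h, diag_snoc_false_of_le h, CapDiagram.th_addThrough]
        rcases lt_or_ge (low w) (diag w).th with hw | hw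
        · rw [low_snoc_false_of_lt hw, diag_snoc_false_of_lt hw,
            CapDiagram.th_addClose _ (by omega)]
          omega
        · rw [low_snoc_false_of_le hw, diag_snoc_false_of_le hw, CapDiagram.th_addThrough]
          omega
    · simp only [low_snoc_true, diag_snoc_true, CapDiagram.th_addThrough]
      omega

theorem dropLast_addThrough {n : ℕ} (x : CapDiagram n) :
    CapDiagram.dropLast x.addThrough = x := rfl

theorem dropLast_addClose {n : ℕ} (x : CapDiagram n) : CapDiagram.dropLast x.addClose = x := by
  obtain ⟨_ | t, x⟩ := x <;> rfl

theorem dropLast_diag_snoc {n : ℕ} (u : Word n) (b : Bool) :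
    CapDiagram.dropLast (diag (snoc u b)) = diag u := by
  cases b
  · rcases lt_or_ge (low u) (diag u).th with h | h
    · rw [diag_snoc_false_of_lt h, dropLast_addClose]
    · rw [diag_snoc_false_of_le h, dropLast_addThrough]
  · rw [diag_snoc_true, dropLast_addThrough]

/-- Matching brackets inside a prefix does not depend on what follows. -/
theorem le_diag_append {m n : ℕ} (u : Word m) (v : Word n) :
    CapDiagram.le m n (diag (Fin.append u v : Word (m + n))) = diag u := by
  induction n with
  | zero =>
    rw [Subsingleton.elim v Fin.elim0, Fin.append_elim0]; rfl
  | succ n ih =>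
    obtain ⟨v, b, rfl⟩ := exists_snoc v
    rw [append_snoc]
    exact (congrArg (CapDiagram.le m n) (dropLast_diag_snoc _ b)).trans (ih v)

theorem head_throughs_gt_iff {n t : ℕ} (m : ℕ) (x : CapDiagramTo n t) :
    (∃ i ∈ (CapDiagram.throughs x).head?, m < i) ↔
      0 < (CapDiagram.throughs x).countP (m < ·) := by
  have hp := CapDiagram.pairwise_throughs x
  revert hp
  generalize CapDiagram.throughs x = L
  rcases L with _ | ⟨a, L⟩
  · simp
  intro hp
  rw [List.countP_pos_iff]
  simp only [List.head?_cons, Option.mem_def, Option.some.injEq, exists_eq_left',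
    List.mem_cons, decide_eq_true_eq]
  refine ⟨fun h => ⟨a, .inl rfl, h⟩, ?_⟩
  rintro ⟨i, rfl | hi, h⟩
  · exact h
  · exact h.trans ((List.pairwise_cons.1 hp).1 i hi)

theorem gt_addThrough {m n : ℕ} (x : CapDiagram (m + n)) :
    CapDiagram.gt m (n + 1) x.addThrough = (CapDiagram.gt m n x).addThrough := rfl

/-- The last strand is capped with a strand at a position `≤ m` iff no through-strand starts at a
position `> m`; by `th_le_gt` this can be read off from the numbers of through-strands. -/
theorem gt_addClose {m n : ℕ} (x : CapDiagram (m + n)) (h : 0 < x.th) :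
    CapDiagram.gt m (n + 1) x.addClose =
      if (CapDiagram.gt m n x).th + x.th = (CapDiagram.le m n x).th
      then (CapDiagram.gt m n x).addThrough else (CapDiagram.gt m n x).addClose := by
  obtain ⟨_ | t, x⟩ := x
  · exact absurd h (lt_irrefl 0)
  obtain ⟨h, h1, h2⟩ := CapDiagram.th_le_gt m n x
  have h3 := CapDiagram.length_throughs x
  have h4 : (CapDiagram.throughs x).length = (CapDiagram.throughs x).countP (· ≤ m) +
      (CapDiagram.throughs x).countP (m < ·) := by
    simpa using List.length_eq_countP_add_countP (fun i => decide (i ≤ m))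
      (l := CapDiagram.throughs x)
  change (if ∃ i ∈ (CapDiagram.throughs x).head?, m < i then _ else _) = _
  simp only [head_throughs_gt_iff]
  split_ifs with h5 h6 h6
  · exfalso
    change _ + (t + 1) = _ at h6
    omega
  · rfl
  · rfl
  · exfalso
    change ¬ (_ + (t + 1) = _) at h6
    omega

/-- Matching brackets inside a suffix does not depend on what precedes. -/
theorem gt_diag_append {m n : ℕ} (u : Word m) (v : Word n) :
    CapDiagram.gt m n (diag (Fin.append u v : Word (m + n))) = diag v := by
  induction n with
  | zero => rfl
  | succ n ih =>
    obtain ⟨v, b, rfl⟩ := exists_snoc v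
    rw [append_snoc]
    have ih := ih v
    have hl := le_diag_append u v
    have hu := low_le u
    have hv := low_le v
    have hw := th_low_append u v
    revert ih hw hl
    generalize (Fin.append u v : Word (m + n)) = w
    rintro h1 h2 ⟨h3, h4⟩
    simp only [links] at *
    cases b
    · rcases lt_or_ge (low w) (diag w).th with hw | hw
      · rw [diag_snoc_false_of_lt hw, gt_addClose _ (by omega), h1, h2]
        rcases lt_or_ge (low v) (diag v).th with h | h
        · rw [if_neg (by omega), diag_snoc_false_of_lt h]
        · rw [if_pos (by omega), diag_snoc_false_of_le h]
      · rw [diag_snoc_false_of_le hw, gt_addThrough, h1, diag_snoc_false_of_le (by omega)]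
    · rw [diag_snoc_true, diag_snoc_true, gt_addThrough, h1]

theorem hk_diag_append {m n : ℕ} (u : Word m) (v : Word n) :
    CapDiagram.hk m n (diag (Fin.append u v : Word (m + n))) = links u v := by
  rw [CapDiagram.hk, le_diag_append, gt_diag_append]
  have := (th_low_append u v).1
  omega

/-! ### Hookings and the map `κ` in terms of words -/

theorem join_addThrough {a n : ℕ} (x : CapDiagram n) :
    CapDiagram.join a x.addThrough.2 =
      if x.th = a + 1 then x.addClose else (CapDiagram.join a x.2).addThrough := by
  obtain ⟨t, x⟩ := x
  change CapDiagram.join a x.through = _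
  cases t <;> simp [CapDiagram.join, CapDiagram.th]

theorem join_addClose {a n : ℕ} (x : CapDiagram n) (h : 0 < x.th) :
    CapDiagram.join a x.addClose.2 = (CapDiagram.join a x.2).addClose := by
  obtain ⟨_ | t, x⟩ := x
  · exact absurd h (lt_irrefl 0)
  rfl

theorem concat_addThrough {m n : ℕ} (y : CapDiagram m) (z : CapDiagram n) :
    CapDiagram.concat y z.addThrough = (CapDiagram.concat y z).addThrough := rfl

theorem concat_addClose {m n : ℕ} (y : CapDiagram m) (z : CapDiagram n) (h : 0 < z.th) :
    CapDiagram.concat y z.addClose = (CapDiagram.concat y z).addClose := by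
  obtain ⟨_ | t, z⟩ := z
  · exact absurd h (lt_irrefl 0)
  rfl

theorem hooking_addThrough {m n : ℕ} (y : CapDiagram m) (z : CapDiagram n) {l : ℕ}
    (hy : l ≤ y.th) (hz : l ≤ z.th) :
    CapDiagram.hooking y z.addThrough l = (CapDiagram.hooking y z l).addThrough := by
  induction l with
  | zero => exact concat_addThrough y z
  | succ l ih =>
    have h := CapDiagram.th_hooking y z l (by omega) (by omega)
    rw [CapDiagram.hooking, ih (by omega) (by omega), join_addThrough, if_neg (by omega)]
    rfl

theorem hooking_addThrough_succ {m n : ℕ} (y : CapDiagram m) (z : CapDiagram n)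
    (hy : z.th < y.th) :
    CapDiagram.hooking y z.addThrough (z.th + 1) = (CapDiagram.hooking y z z.th).addClose := by
  have h := CapDiagram.th_hooking y z z.th (by omega) (by omega)
  rw [CapDiagram.hooking, hooking_addThrough _ _ (by omega) (by omega), join_addThrough,
    if_pos (by omega)]

theorem hooking_addClose {m n : ℕ} (y : CapDiagram m) (z : CapDiagram n) {l : ℕ}
    (hy : l ≤ y.th) (hz : l < z.th) :
    CapDiagram.hooking y z.addClose l = (CapDiagram.hooking y z l).addClose := by
  induction l with
  | zero => exact concat_addClose y z hz
  | succ l ih =>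
    have h := CapDiagram.th_hooking y z l (by omega) (by omega)
    rw [CapDiagram.hooking, ih (by omega) (by omega), join_addClose _ (by omega)]
    rfl

/-- The cap diagram of a concatenation is the hooking along the newly matched brackets. -/
theorem diag_append {m n : ℕ} (u : Word m) (v : Word n) :
    diag (Fin.append u v : Word (m + n)) = CapDiagram.hooking (diag u) (diag v) (links u v) := by
  induction n with
  | zero =>
    rw [Subsingleton.elim v Fin.elim0, Fin.append_elim0]
    simp only [links, low_zero, Nat.min_zero]
    rfl
  | succ n ih =>
    obtain ⟨v, b, rfl⟩ := exists_snoc v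
    rw [append_snoc]
    have ih := ih v
    have hu := low_le u
    have hv := low_le v
    have hw := th_low_append u v
    revert ih hw
    generalize (Fin.append u v : Word (m + n)) = w
    rintro h1 ⟨h3, h4⟩
    simp only [links] at *
    cases b
    · rcases lt_or_ge (low v) (diag v).th with h | h
      · rw [diag_snoc_false_of_lt h, low_snoc_false_of_lt h, diag_snoc_false_of_lt (by omega),
          hooking_addClose _ _ (by omega) (by omega), h1]
      · rw [diag_snoc_false_of_le h, low_snoc_false_of_le h]
        rcases lt_or_ge (low w) (diag w).th with hw | hw
        · have e : min ((diag u).th - low u) (low v) = (diag v).th := by omega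
          have e' : min ((diag u).th - low u) (low v + 1) = (diag v).th + 1 := by omega
          rw [diag_snoc_false_of_lt hw, e', hooking_addThrough_succ _ _ (by omega), h1, e]
        · have e' : min ((diag u).th - low u) (low v + 1) =
            min ((diag u).th - low u) (low v) := by omega
          rw [diag_snoc_false_of_le hw, e', hooking_addThrough _ _ (by omega) (by omega), h1]
    · rw [diag_snoc_true, diag_snoc_true, low_snoc_true,
        hooking_addThrough _ _ (by omega) (by omega), h1]

/-- Exchange the two parts of a word of length `m + n`, applying `evac` to both of them. If the
parts reduce to `false ^ a * true ^ b` and `false ^ c * true ^ d`, their images in the new order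
reduce to `false ^ d * true ^ c` and `false ^ b * true ^ a`, so that the number `min b c` of links
is kept. -/
def exchange (m n : ℕ) (u : Word (m + n)) : Word (n + m) :=
  Fin.append (evac fun i => u (i.natAdd m) : Word n) (evac fun i => u (i.castAdd n) : Word m)

theorem exchange_append {m n : ℕ} (u : Word m) (v : Word n) :
    exchange m n (Fin.append u v) = Fin.append (evac v) (evac u) := by
  simp [exchange]

theorem exists_append {m n : ℕ} (u : Word (m + n)) :
    ∃ (v : Word m) (w : Word n), u = Fin.append v w :=
  ⟨_, _, Fin.append_castAdd_natAdd.symm⟩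

theorem append_inj {m n : ℕ} {u u' : Word m} {v v' : Word n} :
    (Fin.append u v : Word (m + n)) = Fin.append u' v' ↔ u = u' ∧ v = v' := by
  refine ⟨fun h => ⟨funext fun i => ?_, funext fun i => ?_⟩, fun h => by rw [h.1, h.2]⟩
  · simpa using congrFun h (i.castAdd n)
  · simpa using congrFun h (i.natAdd m)

@[simp] theorem exchange_exchange {m n : ℕ} (u : Word (m + n)) :
    exchange n m (exchange m n u) = u := by
  obtain ⟨v, w, rfl⟩ := exists_append u
  simp [exchange_append]

theorem links_evac {m n : ℕ} (u : Word m) (v : Word n) :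
    links (evac v) (evac u) = links u v := by
  have := low_le u
  have := low_le v
  simp only [links, diag_evac, low_evac]
  omega

/-- `κ` is the effect on cap diagrams of exchanging the two parts of a word by `exchange`. -/
theorem diag_exchange {m n : ℕ} (u : Word (m + n)) :
    diag (exchange m n u) = CapDiagram.kappa m n (diag u) := by
  obtain ⟨v, w, rfl⟩ := exists_append u
  rw [exchange_append, diag_append, links_evac, diag_evac, diag_evac, CapDiagram.kappa,
    hk_diag_append, le_diag_append, gt_diag_append]

theorem low_exchange {m n : ℕ} (u : Word (m + n)) :
    low (exchange m n u) = (diag u).th - low u := by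
  obtain ⟨v, w, rfl⟩ := exists_append u
  have h1 := th_low_append v w
  have h2 := (th_low_append (evac w) (evac v)).2
  have := low_le v
  have := low_le w
  rw [links_evac, low_evac, low_evac] at h2
  rw [exchange_append]
  omega

/-- Both maps reverse the connected components of the crystal of words. -/
theorem evac_exchange {m n : ℕ} (u : Word (m + n)) :
    evac (exchange m n u) = exchange m n (evac u) := by
  have := low_le u
  refine ext_diag (by simp [diag_exchange]) ?_
  rw [low_evac, low_exchange, low_exchange, diag_exchange, CapDiagram.th_kappa, diag_evac, low_evac]

/-- The commutor on words: the Henriques–Kamnitzer commutor of the crystal of words. The outer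
`evac` restores the order of every connected component of the crystal, which `exchange` reverses.
-/
def comm (m n : ℕ) (u : Word (m + n)) : Word (n + m) := evac (exchange m n u)

/-- Together with `homMat_unit`, this identifies the matrix of the commutor. -/
theorem eq_comm_iff {m n : ℕ} (u : Word (m + n)) (v : Word (n + m)) :
    v = comm m n u ↔ diag v = CapDiagram.kappa m n (diag u) ∧ low v = low u := by
  have := low_le u
  have h1 : diag (comm m n u) = CapDiagram.kappa m n (diag u) := by simp [comm, diag_exchange]
  have h2 : low (comm m n u) = low u := by
    rw [comm, low_evac, low_exchange, diag_exchange, CapDiagram.th_kappa]; omega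
  constructor
  · rintro rfl; exact ⟨h1, h2⟩
  · rintro ⟨h3, h4⟩; exact ext_diag (h3.trans h1.symm) (h4.trans h2.symm)

@[simp] theorem comm_comm {m n : ℕ} (u : Word (m + n)) : comm n m (comm m n u) = u := by
  rw [comm, comm, ← evac_exchange, exchange_exchange, evac_evac]

end Word

/-! ### The matrix representation -/

/-- The Iverson bracket: `1` if `P` holds, and `0` otherwise. -/
noncomputable def iverson (k : Type u) [Field k] (P : Prop) : k :=
  open Classical in if P then 1 else 0

section
variable {k : Type u} [Field k]

theorem iverson_true {P : Prop} (h : P) : iverson k P = 1 := if_pos h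

theorem iverson_false {P : Prop} (h : ¬ P) : iverson k P = 0 := if_neg h

theorem iverson_congr {P Q : Prop} (h : P ↔ Q) : iverson k P = iverson k Q := by rw [propext h]

theorem ite_eq_iverson {P : Prop} [Decidable P] : (if P then (1 : k) else 0) = iverson k P := by
  by_cases h : P
  · rw [if_pos h, iverson_true h]
  · rw [if_neg h, iverson_false h]

theorem iverson_mul (P Q : Prop) : iverson k P * iverson k Q = iverson k (P ∧ Q) := by
  by_cases hP : P <;> by_cases hQ : Q <;> simp [iverson, hP, hQ]

theorem sum_iverson {ι : Type*} [Fintype ι] {P : ι → Prop} (h : ∀ i j, P i → P j → i = j) :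
    ∑ i, iverson k (P i) = iverson k (∃ i, P i) := by
  by_cases hP : ∃ i, P i
  · obtain ⟨i, hi⟩ := hP
    rw [iverson_true ⟨i, hi⟩, Finset.sum_eq_single i, iverson_true hi]
    · exact fun j _ hj => iverson_false fun h' => hj (h _ _ h' hi)
    · simp
  · rw [iverson_false hP]
    exact Finset.sum_eq_zero fun i _ => iverson_false fun h => hP ⟨i, h⟩

theorem one_apply_eq_iverson {n : ℕ} (u v : Word n) :
    (1 : Matrix (Word n) (Word n) k) u v = iverson k (u = v) := by
  rw [Matrix.one_apply, ite_eq_iverson]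

namespace TL0

theorem homMat_comp {X Y Z : TL0 k} (f : X ⟶ Y) (g : Y ⟶ Z) :
    homMat (f ≫ g) = homMat f * homMat g := by
  obtain ⟨f, rfl⟩ := mk_surj f
  obtain ⟨g, rfl⟩ := mk_surj g
  rfl

/-- The matrix of a morphism, as a linear map. -/
noncomputable def homMatLinear (X Y : TL0 k) :
    (X ⟶ Y) →ₗ[k] Matrix (Word X.strands) (Word Y.strands) k where
  toFun := homMat
  map_add' f g := by
    obtain ⟨f, rfl⟩ := mk_surj f
    obtain ⟨g, rfl⟩ := mk_surj g
    rfl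
  map_smul' a f := by
    obtain ⟨f, rfl⟩ := mk_surj f
    rfl

theorem homMat_sum {X Y : TL0 k} {ι : Type*} (s : Finset ι) (f : ι → (X ⟶ Y)) :
    homMat (∑ i ∈ s, f i) = ∑ i ∈ s, homMat (f i) := map_sum (homMatLinear X Y) f s

theorem homMat_smul {X Y : TL0 k} (a : k) (f : X ⟶ Y) : homMat (a • f) = a • homMat f :=
  (homMatLinear X Y).map_smul a f

theorem homMat_tensor {m n m' n' : ℕ} (f : (obj m : TL0 k) ⟶ obj n)
    (g : (obj m' : TL0 k) ⟶ obj n') (u : Word m) (u' : Word m') (v : Word n) (v' : Word n') :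
    homMat (f ⊗ₘ g) (Fin.append u u') (Fin.append v v') = homMat f u v * homMat g u' v' := by
  obtain ⟨f, rfl⟩ := mk_surj f
  obtain ⟨g, rfl⟩ := mk_surj g
  change TLTerm.mat f (fun i => (Fin.append u u' : Word (m + m')) (i.castAdd m'))
    (fun i => (Fin.append v v' : Word (n + n')) (i.castAdd n')) *
    TLTerm.mat g (fun i => (Fin.append u u' : Word (m + m')) (i.natAdd m))
      (fun i => (Fin.append v v' : Word (n + n')) (i.natAdd n)) = _
  simp only [Fin.append_left, Fin.append_right]
  rfl

theorem homMat_bar {X Y : TL0 k} (f : X ⟶ Y) : homMat (bar f) = (homMat f).transpose := by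
  suffices h : ∀ {m n : ℕ} (f : TLTerm k m n), f.bar.mat = f.mat.transpose by
    obtain ⟨f, rfl⟩ := mk_surj f
    exact h f
  intro m n f
  induction f with
  | id n => simp [TLTerm.bar, TLTerm.mat]
  | cup => rfl
  | cap => rfl
  | comp f g hf hg =>
    simp only [TLTerm.bar, TLTerm.mat, Matrix.transpose_mul]
    rw [hf, hg]
  | tensor f g hf hg =>
    ext u v
    simp only [TLTerm.bar, TLTerm.mat, Matrix.transpose_apply, Matrix.of_apply]
    rw [hf, hg]; rfl
  | zero m n => simp [TLTerm.bar, TLTerm.mat]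
  | add f g hf hg =>
    simp only [TLTerm.bar, TLTerm.mat, Matrix.transpose_add]
    rw [hf, hg]
  | smul a f hf =>
    simp only [TLTerm.bar, TLTerm.mat, Matrix.transpose_smul]
    rw [hf]

end TL0

variable (k)

/-- A cap diagram acts on words as the inverse of the injection `fill`. -/
theorem CapDiagramTo.homMat_toHom {n t : ℕ} (x : CapDiagramTo n t) (u : Word n) (w : Word t) :
    TL0.homMat (x.toHom k) u w = iverson k (u = x.fill w) := by
  induction x with
  | nil =>
    rw [iverson_true (Subsingleton.elim _ _), Subsingleton.elim u w]
    exact Matrix.one_apply_eq _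
  | through x ih =>
    obtain ⟨u, b, rfl⟩ := exists_snoc u
    obtain ⟨w, c, rfl⟩ := exists_snoc w
    rw [homMat_through]
    simp only [snoc_castSucc, snoc_last, fill_through, snoc_inj]
    rw [ih, ite_eq_iverson, iverson_mul]
  | close x ih =>
    obtain ⟨u, b, rfl⟩ := exists_snoc u
    rw [homMat_close]
    simp only [snoc_castSucc, snoc_last, fill, snoc_inj]
    rw [ih, ite_eq_iverson, iverson_mul]
    rfl

end

/-! ### Descents and the matrix of a Jones–Wenzl projector -/

namespace Word

/-- The letter number `i` (counted from `0`), if there is one. -/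
def letter {n : ℕ} (u : Word n) (i : ℕ) : Option Bool :=
  if h : i < n then some (u ⟨i, h⟩) else none

theorem letter_snoc {n : ℕ} (u : Word n) (b : Bool) (i : ℕ) :
    letter (snoc u b) i = if i = n then some b else letter u i := by
  rcases lt_trichotomy i n with h | rfl | h
  · rw [if_neg h.ne, letter, dif_pos (h.trans (Nat.lt_succ_self _)), letter, dif_pos h]
    exact congrArg some (snoc_castSucc u b ⟨i, h⟩)
  · rw [if_pos rfl, letter, dif_pos (Nat.lt_succ_self _)]
    exact congrArg some (snoc_last u b)
  · rw [if_neg h.ne', letter, dif_neg (by omega), letter, dif_neg (by omega)]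

theorem letter_sorted {t a i : ℕ} {b : Bool} (h : letter (sorted t a) i = some b) :
    b = decide (a ≤ i) := by
  rw [letter] at h
  split_ifs at h
  exact (Option.some.inj h).symm

/-- The positions `i` such that the letters number `i` and `i + 1` (counted from `1`) are an opening
and a closing bracket. -/
def descents {n : ℕ} (u : Word n) : Finset ℕ :=
  (Finset.Icc 1 n).filter fun i => letter u (i - 1) = some true ∧ letter u i = some false

theorem mem_descents {n : ℕ} {u : Word n} {i : ℕ} :
    i ∈ descents u ↔ 0 < i ∧ letter u (i - 1) = some true ∧ letter u i = some false := by
  simp only [descents, Finset.mem_filter, Finset.mem_Icc]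
  refine ⟨fun h => ⟨h.1.1, h.2⟩, fun h => ⟨⟨h.1, ?_⟩, h.2⟩⟩
  by_contra hn
  have := h.2.2
  rw [letter, dif_neg (by omega)] at this
  simp at this

theorem descents_snoc {n : ℕ} (u : Word n) (b : Bool) {i : ℕ} (hi : i < n) :
    i ∈ descents (snoc u b) ↔ i ∈ descents u := by
  rw [mem_descents, mem_descents, letter_snoc, letter_snoc, if_neg (by omega), if_neg (by omega)]

theorem descents_eq_empty_iff {n : ℕ} (u : Word n) :
    descents u = ∅ ↔ ∃ a ≤ n, u = sorted n a := by
  constructor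
  · intro h
    induction n with
    | zero => exact ⟨0, le_rfl, Subsingleton.elim _ _⟩
    | succ n ih =>
      obtain ⟨u, b, rfl⟩ := exists_snoc u
      have h' (i : ℕ) : i ∉ descents (snoc u b) := by rw [h]; simp
      obtain ⟨a, ha, rfl⟩ := ih u (by
        refine Finset.eq_empty_of_forall_notMem fun i hi => h' i ?_
        refine (descents_snoc u b ?_).2 hi
        have := (mem_descents.1 hi).2.2
        by_contra hn
        rw [letter, dif_neg hn] at this
        simp at this)
      cases b
      · rcases Nat.lt_or_ge a n with han | han
        · refine absurd (mem_descents.2 ⟨by omega, ?_, ?_⟩) (h' n)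
          · rw [letter_snoc, if_neg (by omega), letter, dif_pos (by omega)]
            simp [sorted]; omega
          · rw [letter_snoc, if_pos rfl]
        · refine ⟨n + 1, le_rfl, ?_⟩
          rw [sorted_succ, sorted_congr han (Nat.le_succ n)]
          simp
      · exact ⟨a, by omega, by rw [sorted_succ, decide_eq_true ha]⟩
  · rintro ⟨a, _, rfl⟩
    refine Finset.eq_empty_of_forall_notMem fun i hi => ?_
    obtain ⟨h1, h2, h3⟩ := mem_descents.1 hi
    have h2 := letter_sorted h2
    have h3 := letter_sorted h3
    simp at h2 h3
    omega

end Word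

/-- The caps of `capSet I n` match the brackets of a word iff all elements of `I` are descents. -/
theorem exists_fill_capSet_iff {I : Finset ℕ} (h0 : 0 ∉ I) (hI : ∀ i ∈ I, i - 1 ∉ I) (n : ℕ)
    (u : Word n) : (∃ w, u = (capSet I n).2.fill w) ↔ ∀ i ∈ I, i < n → i ∈ descents u := by
  induction n using Nat.strong_induction_on with
  | _ n ih =>
    match n with
    | 0 => exact ⟨fun _ i _ h => absurd h (Nat.not_lt_zero i), fun _ => ⟨u, rfl⟩⟩
    | n + 1 =>
      obtain ⟨u, b, rfl⟩ := exists_snoc u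
      by_cases hn : n ∈ I
      · obtain ⟨p, rfl⟩ : ∃ p, n = p + 1 :=
          ⟨n - 1, by have : n ≠ 0 := fun h => h0 (h ▸ hn); omega⟩
        obtain ⟨u, c, rfl⟩ := exists_snoc u
        have hp : p ∉ I := hI _ hn
        have e : capSet I (p + 2) = (capSet I p).addThrough.addClose := by
          simp only [capSet, if_pos hn, if_neg hp]
        have h1 : (∃ w, snoc (snoc u c) b = (capSet I (p + 2)).2.fill w) ↔
            (∃ w, u = (capSet I p).2.fill w) ∧ c = true ∧ b = false := by
          rw [e]
          generalize capSet I p = x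
          obtain ⟨t, x⟩ := x
          change (∃ w, _ = x.through.close.fill w) ↔ _
          simp only [CapDiagramTo.fill, Word.init_snoc, snoc_last, snoc_inj]
          exact ⟨fun ⟨w, h⟩ => ⟨⟨w, h.1.1⟩, h.1.2, h.2⟩,
            fun ⟨⟨w, h⟩, h'⟩ => ⟨w, ⟨h, h'.1⟩, h'.2⟩⟩
        rw [h1, ih p (by omega)]
        have h2 : p + 1 ∈ descents (snoc (snoc u c) b) ↔ c = true ∧ b = false := by
          rw [mem_descents]
          simp [letter_snoc]
        constructor
        · rintro ⟨h, hc⟩ i hi hip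
          obtain rfl | hip : i = p + 1 ∨ i < p + 1 := by omega
          · exact h2.2 hc
          · have : i ≠ p := fun h => hp (h ▸ hi)
            rw [descents_snoc _ _ hip, descents_snoc _ _ (by omega)]
            exact h i hi (by omega)
        · intro h
          refine ⟨fun i hi hip => ?_, h2.1 (h _ hn (by omega))⟩
          have := h i hi (by omega)
          rwa [descents_snoc _ _ (by omega), descents_snoc _ _ (by omega)] at this
      · have e : capSet I (n + 1) = (capSet I n).addThrough := by simp only [capSet, if_neg hn]
        have h1 : (∃ w, snoc u b = (capSet I (n + 1)).2.fill w) ↔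
            (∃ w, u = (capSet I n).2.fill w) := by
          rw [e]
          generalize capSet I n = x
          obtain ⟨t, x⟩ := x
          change (∃ w, _ = x.through.fill w) ↔ _
          constructor
          · rintro ⟨w, h⟩
            obtain ⟨w, c, rfl⟩ := exists_snoc w
            rw [CapDiagramTo.fill_through, snoc_inj] at h
            exact ⟨w, h.1⟩
          · rintro ⟨w, h⟩
            exact ⟨snoc w b, by rw [CapDiagramTo.fill_through, h]⟩
        rw [h1, ih n (by omega)]
        constructor
        · intro h i hi hin
          have : i ≠ n := fun h => hn (h ▸ hi)
          rw [descents_snoc _ _ (by omega)]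
          exact h i hi (by omega)
        · intro h i hi hin
          have := h i hi (by omega)
          rwa [descents_snoc _ _ hin] at this

/-- Sets of descents are automatically apt. -/
theorem filter_aptSubsets {n : ℕ} (u : Word n) :
    (aptSubsets n).filter (· ⊆ descents u) = (descents u).powerset := by
  ext I
  simp only [aptSubsets, Finset.mem_filter, Finset.mem_powerset]
  refine ⟨fun h => h.2, fun h => ⟨⟨fun i hi => (Finset.mem_filter.1 (h hi)).1, ?_, ?_⟩, h⟩⟩
  · intro hn
    have := (mem_descents.1 (h hn)).2.2
    simp [letter] at this
  · intro i hi
    obtain ⟨h1, h2, h3⟩ := mem_descents.1 (h hi)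
    constructor
    · intro hj
      have := (mem_descents.1 (h hj)).2.2
      rw [h2] at this
      simp at this
    · intro hj
      have := (mem_descents.1 (h hj)).2.1
      rw [Nat.add_sub_cancel, h3] at this
      simp at this

section
variable (k : Type u) [Field k]

theorem homMat_toHom_bar_toHom {n t : ℕ} (x : CapDiagramTo n t) (u v : Word n) :
    TL0.homMat (x.toHom k ≫ TL0.bar (x.toHom k)) u v =
      iverson k (u = v ∧ ∃ w, u = x.fill w) := by
  rw [TL0.homMat_comp, TL0.homMat_bar, Matrix.mul_apply]
  have e (w : Word t) : TL0.homMat (x.toHom k) u w * (TL0.homMat (x.toHom k)).transpose w v =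
      iverson k (u = x.fill w ∧ v = x.fill w) := by
    rw [Matrix.transpose_apply, x.homMat_toHom k, x.homMat_toHom k, iverson_mul]
  refine (Finset.sum_congr rfl fun w _ => e w).trans ?_
  rw [sum_iverson fun w w' h h' => x.fill_injective (h.1.symm.trans h'.1)]
  refine iverson_congr ⟨fun ⟨w, h, h'⟩ => ⟨h.trans h'.symm, w, h⟩, ?_⟩
  rintro ⟨rfl, w, h⟩
  exact ⟨w, h, h⟩

/-- The Jones–Wenzl projector projects onto the words without matching brackets: summing the signs
of all sets of descents of a word gives `0` unless there are no descents. -/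
theorem homMat_jonesWenzl (n : ℕ) (u v : Word n) :
    TL0.homMat (jonesWenzl k n) u v = iverson k (u = v ∧ ∃ a ≤ n, u = sorted n a) := by
  rw [jonesWenzl, TL0.homMat_sum, Matrix.sum_apply, ← descents_eq_empty_iff]
  have e (I : Finset ℕ) (hI : I ∈ aptSubsets n) :
      TL0.homMat ((-1 : k) ^ I.card •
        ((capSet I n).toHom k ≫ TL0.bar ((capSet I n).toHom k))) u v =
      iverson k (u = v) * (if I ⊆ descents u then (-1 : k) ^ I.card else 0) := by
    obtain ⟨h1, h2, h3⟩ := Finset.mem_filter.1 hI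
    have h1 := Finset.mem_powerset.1 h1
    rw [TL0.homMat_smul]
    have h := homMat_toHom_bar_toHom k (capSet I n).2 u v
    rw [exists_fill_capSet_iff (fun h => by simpa using h1 h) (fun i hi => (h3 i hi).1)] at h
    have h4 : (∀ i ∈ I, i < n → i ∈ descents u) ↔ I ⊆ descents u := by
      refine ⟨fun h i hi => h i hi ?_, fun h i hi _ => h hi⟩
      have : i ≠ n := fun h => h2 (h ▸ hi)
      have := (Finset.mem_Icc.1 (h1 hi)).2
      omega
    rw [h4, ← iverson_mul] at h
    refine (congrArg ((-1 : k) ^ I.card * ·) h).trans ?_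
    rw [mul_left_comm, ← ite_eq_iverson (P := I ⊆ descents u), mul_ite, mul_one, mul_zero]
  refine (Finset.sum_congr rfl e).trans ?_
  rw [← Finset.mul_sum, ← iverson_mul, ← Finset.sum_filter, filter_aptSubsets, ← ite_eq_iverson
    (P := descents u = ∅)]
  have := congrArg (Int.cast : ℤ → k) (Finset.sum_powerset_neg_one_pow_card (x := descents u))
  push_cast at this
  rw [this]

/-- The morphism `\overline{y} ∘ j ∘ x` sends every word with cap diagram `x` to the word with cap
diagram `y` and the same reduced word, and all other words to `0`. -/
theorem homMat_unit {m n : ℕ} (x : CapDiagram m) (y : CapDiagram n) (h : y.th = x.th)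
    (u : Word m) (v : Word n) :
    TL0.homMat (x.toHom k ≫ jonesWenzl k x.th ≫ eqToHom (congrArg TL0.obj h.symm) ≫
      TL0.bar (y.toHom k)) u v = iverson k (diag u = x ∧ diag v = y ∧ low u = low v) := by
  obtain ⟨t, x⟩ := x
  obtain ⟨s, y⟩ := y
  simp only [CapDiagram.th] at h
  subst h
  change TL0.homMat (x.toHom k ≫ jonesWenzl k s ≫ 𝟙 _ ≫ TL0.bar (y.toHom k)) u v = _
  rw [Category.id_comp, TL0.homMat_comp, TL0.homMat_comp, TL0.homMat_bar, Matrix.mul_apply]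
  have e (w : Word s) : TL0.homMat (x.toHom k) u w *
      (TL0.homMat (jonesWenzl k s) * (TL0.homMat (y.toHom k)).transpose) w v =
      iverson k ((∃ a ≤ s, w = sorted s a) ∧ u = x.fill w ∧ v = y.fill w) := by
    rw [Matrix.mul_apply, x.homMat_toHom k]
    have e' (w' : Word s) : TL0.homMat (jonesWenzl k s) w w' *
        (TL0.homMat (y.toHom k)).transpose w' v =
        iverson k ((w = w' ∧ ∃ a ≤ s, w = sorted s a) ∧ v = y.fill w') := by
      rw [homMat_jonesWenzl, Matrix.transpose_apply, y.homMat_toHom k, iverson_mul]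
    refine (congrArg (_ * ·) ((Finset.sum_congr rfl fun w' _ => e' w').trans
      (sum_iverson fun _ _ h h' => h.1.1.symm.trans h'.1.1))).trans ?_
    rw [iverson_mul]
    refine iverson_congr ⟨?_, fun h => ⟨h.2.1, w, ⟨rfl, h.1⟩, h.2.2⟩⟩
    rintro ⟨h1, _, ⟨rfl, h2⟩, h3⟩
    exact ⟨h2, h1, h3⟩
  refine (Finset.sum_congr rfl fun w _ => e w).trans ?_
  rw [sum_iverson fun w w' h h' => x.fill_injective (h.2.1.symm.trans h'.2.1)]
  refine iverson_congr ⟨?_, ?_⟩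
  · rintro ⟨_, ⟨a, ha, rfl⟩, rfl, rfl⟩
    obtain ⟨h1, h2⟩ := x.parse_fill_sorted ha
    obtain ⟨h3, h4⟩ := y.parse_fill_sorted ha
    exact ⟨h1, h3, h2.trans h4.symm⟩
  · rintro ⟨h1, h2, h3⟩
    have hu := fill_diag u
    have hv := fill_diag v
    have ha := low_le u
    rw [← h3, h2] at hv
    rw [h1] at hu ha
    exact ⟨sorted s (low u), ⟨_, ha, rfl⟩, hu.symm, hv.symm⟩

theorem homMat_commutor (m n : ℕ) (u : Word (m + n)) (v : Word (n + m)) :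
    TL0.homMat (commutor k m n) u v = iverson k (v = comm m n u) := by
  rw [commutor, TL0.homMat_sum, Matrix.sum_apply]
  have e (x : CapDiagram (m + n)) : TL0.homMat (commutorTerm k m n x) u v =
      iverson k (diag u = x ∧ diag v = CapDiagram.kappa m n x ∧ low u = low v) :=
    homMat_unit k x _ (CapDiagram.th_kappa m n x) u v
  refine (Finset.sum_congr rfl fun x _ => e x).trans ?_
  rw [sum_iverson fun x y h h' => h.1.symm.trans h'.1, eq_comm_iff]
  refine iverson_congr ⟨?_, fun h => ⟨_, rfl, h.1, h.2.symm⟩⟩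
  rintro ⟨_, rfl, h, h'⟩
  exact ⟨h, h'.symm⟩

/-- The morphisms `\overline{x} ∘ j ∘ x` sum up to the identity. -/
theorem homMat_sum_unit (n : ℕ) :
    ∑ x : CapDiagram n, TL0.homMat (x.toHom k ≫ jonesWenzl k x.th ≫ eqToHom rfl ≫
      TL0.bar (x.toHom k)) = 1 := by
  ext u v
  rw [Matrix.sum_apply]
  refine (Finset.sum_congr rfl fun x _ => homMat_unit k x x rfl u v).trans ?_
  rw [sum_iverson fun x y h h' => h.1.symm.trans h'.1]
  refine (iverson_congr ⟨?_, ?_⟩).trans (one_apply_eq_iverson u v).symm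
  · rintro ⟨_, rfl, h, h'⟩
    exact ext_diag h.symm h'
  · rintro rfl
    exact ⟨_, rfl, rfl, rfl⟩

/-- Cap diagrams commute with `evac`: multiplying `x` with the decomposition of the identity
writes it as a sum of morphisms `\overline{y} ∘ j ∘ z`, which keep the reduced words. -/
theorem homMat_toHom_evac {n t : ℕ} (x : CapDiagramTo n t) (u : Word n) (w : Word t) :
    TL0.homMat (x.toHom k) (evac u) (evac w) = TL0.homMat (x.toHom k) u w := by
  choose z hz using fun y : CapDiagram t => CapDiagramTo.exists_toHom_comp (k := k) x y.2
  have e (u : Word n) (w : Word t) : TL0.homMat (x.toHom k) u w =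
      ∑ y : CapDiagram t, iverson k (diag u = ⟨y.th, z y⟩ ∧ diag w = y ∧ low u = low w) := by
    have h : TL0.homMat (x.toHom k) = ∑ y : CapDiagram t, TL0.homMat
        (CapDiagram.toHom k ⟨y.th, z y⟩ ≫ jonesWenzl k y.th ≫ eqToHom rfl ≫
          TL0.bar (y.toHom k)) := by
      rw [← Matrix.mul_one (TL0.homMat (x.toHom k))]
      refine (congrArg (_ * ·) (homMat_sum_unit k t).symm).trans ?_
      rw [Matrix.mul_sum]
      refine Finset.sum_congr rfl fun y _ => ?_
      refine (TL0.homMat_comp _ _).symm.trans (congrArg TL0.homMat ?_)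
      rw [← Category.assoc]
      exact congrArg (· ≫ _) (hz y).symm
    rw [h, Matrix.sum_apply]
    exact Finset.sum_congr rfl fun y _ => homMat_unit k ⟨y.th, z y⟩ y rfl u w
  rw [e, e]
  refine Finset.sum_congr rfl fun y _ => ?_
  have := low_le u
  have := low_le w
  simp only [diag_evac, low_evac]
  refine iverson_congr (and_congr_right fun h => and_congr_right fun h' => ?_)
  have hu : (diag u).th = y.th := by rw [h]; rfl
  have hw : (diag w).th = y.th := by rw [h']
  omega

end

/-! ### Diagrams span the morphism spaces -/

namespace TL0

variable {k : Type u} [Field k]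

theorem bar_id (X : TL0 k) : bar (𝟙 X) = 𝟙 X := rfl

theorem bar_comp {X Y Z : TL0 k} (f : X ⟶ Y) (g : Y ⟶ Z) : bar (f ≫ g) = bar g ≫ bar f := by
  obtain ⟨f, rfl⟩ := mk_surj f
  obtain ⟨g, rfl⟩ := mk_surj g
  rfl

theorem bar_tensor {X Y X' Y' : TL0 k} (f : X ⟶ Y) (g : X' ⟶ Y') :
    bar (f ⊗ₘ g) = (bar f ⊗ₘ bar g) := by
  obtain ⟨f, rfl⟩ := mk_surj f
  obtain ⟨g, rfl⟩ := mk_surj g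
  rfl

theorem bar_zero (X Y : TL0 k) : bar (0 : X ⟶ Y) = 0 := rfl

theorem bar_bar {X Y : TL0 k} (f : X ⟶ Y) : bar (bar f) = f := by
  obtain ⟨f, rfl⟩ := mk_surj f
  suffices h : ∀ {m n : ℕ} (f : TLTerm k m n), f.bar.bar = f from congrArg mk (h f)
  intro m n f
  induction f <;> simp_all [TLTerm.bar]

/-- Add a through-strand on the right of a morphism. -/
def addStrand {m n : ℕ} (f : (obj m : TL0 k) ⟶ obj n) : (obj (m + 1) : TL0 k) ⟶ obj (n + 1) :=
  f ▷ obj 1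

variable (k) in
/-- The cap joining the last two of `t + 2` strands. -/
def capLast (t : ℕ) : (obj (t + 2) : TL0 k) ⟶ obj t := obj t ◁ cap

variable (k) in
/-- The cup joining the last two of `t + 2` strands. -/
def cupLast (t : ℕ) : (obj t : TL0 k) ⟶ obj (t + 2) := obj t ◁ cup

theorem addStrand_comp {l m n : ℕ} (f : (obj l : TL0 k) ⟶ obj m) (g : (obj m : TL0 k) ⟶ obj n) :
    addStrand (f ≫ g) = addStrand f ≫ addStrand g := comp_whiskerRight _ _ _

theorem addStrand_zero (m n : ℕ) : addStrand (0 : (obj m : TL0 k) ⟶ obj n) = 0 :=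
  MonoidalPreadditive.zero_whiskerRight

theorem bar_addStrand {m n : ℕ} (f : (obj m : TL0 k) ⟶ obj n) :
    bar (addStrand f) = addStrand (bar f) := by
  obtain ⟨f, rfl⟩ := mk_surj f
  rfl

theorem bar_capLast (t : ℕ) : bar (capLast k t) = cupLast k t := rfl

theorem bar_cupLast (t : ℕ) : bar (cupLast k t) = capLast k t := rfl

theorem addStrand_addStrand_capLast {m n : ℕ} (f : (obj m : TL0 k) ⟶ obj n) :
    addStrand (addStrand f) ≫ capLast k n = capLast k m ≫ f := by
  obtain ⟨f, rfl⟩ := mk_surj f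
  exact mk_eq (TLRel.slide_cap f)

theorem cupLast_addStrand_addStrand {m n : ℕ} (f : (obj m : TL0 k) ⟶ obj n) :
    cupLast k m ≫ addStrand (addStrand f) = f ≫ cupLast k n := by
  have h := congrArg bar (addStrand_addStrand_capLast (bar f))
  simpa only [bar_comp, bar_addStrand, bar_capLast, bar_bar] using h

theorem cupLast_capLast (t : ℕ) : cupLast k t ≫ capLast k t = 𝟙 _ :=
  mk_eq (.trans (.symm (.tensor_comp (.id t) (.id t) .cup .cap))
    (.trans (.tensor_congr (.id_comp _) .circle) (.tensor_id t 0)))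

theorem addStrand_cupLast_capLast (t : ℕ) :
    addStrand (cupLast k t) ≫ capLast k (t + 1) = 0 := by
  have h : addStrand (cupLast k t) ≫ capLast k (t + 1) =
      obj t ◁ (0 : (obj 1 : TL0 k) ⟶ obj 1) :=
    mk_eq (.trans (.comp_congr (TLRel.assoc_one (.id t) .cup) (.symm (TLRel.id_id_cap t 1)))
      (.trans (.symm (.tensor_comp (.id t) (.id t) _ _))
        (.tensor_congr (.id_comp _) .zigzag_left)))
  exact h.trans MonoidalPreadditive.whiskerLeft_zero

theorem cupLast_addStrand_capLast (t : ℕ) :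
    cupLast k (t + 1) ≫ addStrand (capLast k t) = 0 := by
  have h := congrArg bar (addStrand_cupLast_capLast (k := k) t)
  simpa only [bar_comp, bar_addStrand, bar_capLast, bar_cupLast, bar_zero] using h

theorem toHom_through {n t : ℕ} (x : CapDiagramTo n t) :
    x.through.toHom k = addStrand (x.toHom k) := rfl

theorem toHom_close {n t : ℕ} (x : CapDiagramTo n (t + 1)) :
    x.close.toHom k = addStrand (x.toHom k) ≫ capLast k t := rfl

theorem cupLast_addStrand_close {s r : ℕ} (x : CapDiagramTo s (r + 1)) :
    cupLast k s ≫ addStrand (x.close.toHom k) = 0 := by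
  rw [toHom_close, addStrand_comp, ← Category.assoc, cupLast_addStrand_addStrand, Category.assoc,
    cupLast_addStrand_capLast, Limits.comp_zero]

theorem addStrand_bar_close_capLast {s r : ℕ} (x : CapDiagramTo s (r + 1)) :
    addStrand (bar (x.close.toHom k)) ≫ capLast k s = 0 := by
  have h := congrArg bar (cupLast_addStrand_close (k := k) x)
  simpa only [bar_comp, bar_addStrand, bar_cupLast, bar_zero] using h

theorem cupLast_addStrand_through {s r : ℕ} (x : CapDiagramTo s r) :
    cupLast k s ≫ addStrand (x.through.toHom k) = x.toHom k ≫ cupLast k r :=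
  cupLast_addStrand_addStrand _

theorem addStrand_bar_through_capLast {s r : ℕ} (x : CapDiagramTo s r) :
    addStrand (bar (x.through.toHom k)) ≫ capLast k s = capLast k r ≫ bar (x.toHom k) := by
  rw [toHom_through, bar_addStrand, addStrand_addStrand_capLast]

variable (k) in
/-- The diagram with bottom half `x` and top half the reflection of `y`. -/
def glue {m n t : ℕ} (x : CapDiagramTo m t) (y : CapDiagramTo n t) : (obj m : TL0 k) ⟶ obj n :=
  x.toHom k ≫ bar (y.toHom k)

/-- Reduction of a cap diagram on top of a cup diagram: the innermost pairs cancel by `circle`, or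
the composite vanishes by a zig-zag. -/
theorem bar_toHom_comp_toHom {m s t : ℕ} (y : CapDiagramTo m s) (x : CapDiagramTo m t) :
    bar (y.toHom k) ≫ x.toHom k = 0 ∨ ∃ (r : ℕ) (x' : CapDiagramTo s r) (y' : CapDiagramTo t r),
      bar (y.toHom k) ≫ x.toHom k = glue k x' y' := by
  induction y generalizing t with
  | nil =>
    cases x
    exact .inr ⟨0, .nil, .nil, rfl⟩
  | @through m s y ih =>
    cases x with
    | through x =>
      rw [toHom_through, toHom_through, bar_addStrand, ← addStrand_comp]
      rcases ih x with h | ⟨r, x', y', h⟩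
      · rw [h, addStrand_zero]
        exact .inl rfl
      · rw [h, glue, addStrand_comp, ← bar_addStrand]
        exact .inr ⟨_, x'.through, y'.through, rfl⟩
    | close x =>
      rw [toHom_through, toHom_close, bar_addStrand, ← Category.assoc, ← addStrand_comp]
      rcases ih x with h | ⟨r, x', y', h⟩
      · rw [h, addStrand_zero, Limits.zero_comp]
        exact .inl rfl
      · rw [h, glue, addStrand_comp, Category.assoc]
        cases y' with
        | through y' =>
          rw [addStrand_bar_through_capLast, ← Category.assoc, ← toHom_close]
          exact .inr ⟨_, x'.close, y', rfl⟩
        | close y' =>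
          rw [addStrand_bar_close_capLast, Limits.comp_zero]
          exact .inl rfl
  | @close m s y ih =>
    cases x with
    | through x =>
      rw [toHom_through, toHom_close, bar_comp, bar_addStrand, Category.assoc, ← addStrand_comp]
      rcases ih x with h | ⟨r, x', y', h⟩
      · rw [h, addStrand_zero, Limits.comp_zero]
        exact .inl rfl
      · rw [h, glue, addStrand_comp, bar_capLast, ← Category.assoc]
        cases x' with
        | through x' =>
          rw [cupLast_addStrand_through, Category.assoc]
          refine .inr ⟨_, x', y'.close, ?_⟩
          rw [glue, toHom_close, bar_comp, bar_addStrand, bar_capLast]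
        | close x' =>
          rw [cupLast_addStrand_close, Limits.zero_comp]
          exact .inl rfl
    | @close _ t x =>
      have e : bar (y.close.toHom k) ≫ x.close.toHom k =
          cupLast k s ≫ addStrand (bar (y.toHom k) ≫ x.toHom k) ≫ capLast k t := by
        rw [toHom_close, toHom_close, bar_comp, bar_addStrand, bar_capLast, addStrand_comp]
        simp only [Category.assoc]
      rw [e]
      rcases ih x with h | ⟨r, x', y', h⟩
      · rw [h, addStrand_zero, Limits.zero_comp, Limits.comp_zero]
        exact .inl rfl
      · rw [h, glue, addStrand_comp, Category.assoc]
        cases x' with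
        | close x' =>
          rw [← Category.assoc, cupLast_addStrand_close, Limits.zero_comp]
          exact .inl rfl
        | through x' =>
          cases y' with
          | close y' =>
            rw [addStrand_bar_close_capLast, Limits.comp_zero, Limits.comp_zero]
            exact .inl rfl
          | through y' =>
            rw [← Category.assoc, cupLast_addStrand_through, addStrand_bar_through_capLast,
              Category.assoc, ← Category.assoc (cupLast k _), cupLast_capLast, Category.id_comp]
            exact .inr ⟨_, x', y', rfl⟩

variable (k) in
/-- The span of all diagrams from `m` to `n`. -/
def diagramSpan (m n : ℕ) : Submodule k ((obj m : TL0 k) ⟶ obj n) :=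
  Submodule.span k (Set.range fun p : Σ t, CapDiagramTo m t × CapDiagramTo n t =>
    glue k p.2.1 p.2.2)

theorem glue_mem {m n t : ℕ} (x : CapDiagramTo m t) (y : CapDiagramTo n t) :
    glue k x y ∈ diagramSpan k m n :=
  Submodule.subset_span ⟨⟨t, x, y⟩, rfl⟩

theorem comp_mem_diagramSpan {l m n : ℕ} {f : (obj l : TL0 k) ⟶ obj m}
    {g : (obj m : TL0 k) ⟶ obj n} (hf : f ∈ diagramSpan k l m) (hg : g ∈ diagramSpan k m n) :
    f ≫ g ∈ diagramSpan k l n := by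
  induction hf using Submodule.span_induction with
  | zero => rw [Limits.zero_comp]; exact Submodule.zero_mem _
  | add f f' _ _ h h' => rw [Preadditive.add_comp]; exact Submodule.add_mem _ h h'
  | smul a f _ h => rw [Linear.smul_comp]; exact Submodule.smul_mem _ _ h
  | mem f hf =>
    obtain ⟨⟨s, x, y⟩, rfl⟩ := hf
    induction hg using Submodule.span_induction with
    | zero => rw [Limits.comp_zero]; exact Submodule.zero_mem _
    | add f f' _ _ h h' => rw [Preadditive.comp_add]; exact Submodule.add_mem _ h h'
    | smul a f _ h => rw [Linear.comp_smul]; exact Submodule.smul_mem _ _ h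
    | mem g hg =>
      obtain ⟨⟨t, x', y'⟩, rfl⟩ := hg
      simp only [glue, Category.assoc]
      rw [← Category.assoc (bar _)]
      rcases bar_toHom_comp_toHom (k := k) y x' with h | ⟨r, z, w, h⟩
      · rw [h, Limits.zero_comp, Limits.comp_zero]
        exact Submodule.zero_mem _
      · rw [h, glue]
        obtain ⟨z', hz⟩ := CapDiagramTo.exists_toHom_comp (k := k) x z
        obtain ⟨w', hw⟩ := CapDiagramTo.exists_toHom_comp (k := k) y' w
        have e : x.toHom k ≫ (z.toHom k ≫ bar (w.toHom k)) ≫ bar (y'.toHom k) =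
            glue k z' w' := by
          rw [glue, hz, hw, bar_comp]
          simp only [Category.assoc]
        rw [e]
        exact glue_mem _ _

theorem tensor_mem_diagramSpan {m n m' n' : ℕ} {f : (obj m : TL0 k) ⟶ obj n}
    {g : (obj m' : TL0 k) ⟶ obj n'} (hf : f ∈ diagramSpan k m n)
    (hg : g ∈ diagramSpan k m' n') :
    ((f ⊗ₘ g : _) : (obj (m + m') : TL0 k) ⟶ obj (n + n')) ∈
      diagramSpan k (m + m') (n + n') := by
  induction hf using Submodule.span_induction with
  | zero => rw [MonoidalPreadditive.zero_tensor]; exact Submodule.zero_mem _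
  | add f f' _ _ h h' => rw [MonoidalPreadditive.add_tensor]; exact Submodule.add_mem _ h h'
  | smul a f _ h =>
    have e : ((a • f) ⊗ₘ g) = a • (f ⊗ₘ g) := by
      rw [MonoidalCategory.tensorHom_def, MonoidalCategory.tensorHom_def,
        MonoidalLinear.smul_whiskerRight, Linear.smul_comp]
    rw [e]; exact Submodule.smul_mem _ _ h
  | mem f hf =>
    obtain ⟨⟨s, x, y⟩, rfl⟩ := hf
    induction hg using Submodule.span_induction with
    | zero => rw [MonoidalPreadditive.tensor_zero]; exact Submodule.zero_mem _
    | add f f' _ _ h h' => rw [MonoidalPreadditive.tensor_add]; exact Submodule.add_mem _ h h'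
    | smul a g _ h =>
      have e : (glue k x y ⊗ₘ (a • g)) = a • (glue k x y ⊗ₘ g) := by
        rw [MonoidalCategory.tensorHom_def, MonoidalCategory.tensorHom_def,
          MonoidalLinear.whiskerLeft_smul, Linear.comp_smul]
      change (glue k x y ⊗ₘ (a • g)) ∈ _
      rw [e]; exact Submodule.smul_mem _ _ h
    | mem g hg =>
      obtain ⟨⟨t, x', y'⟩, rfl⟩ := hg
      obtain ⟨z, hz⟩ := CapDiagramTo.exists_toHom_tensor (k := k) x x'
      obtain ⟨w, hw⟩ := CapDiagramTo.exists_toHom_tensor (k := k) y y'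
      have e : (glue k x y ⊗ₘ glue k x' y') = glue k z w := by
        rw [glue, glue, glue, hz, hw, bar_tensor, ← tensorHom_comp_tensorHom]
      change (glue k x y ⊗ₘ glue k x' y') ∈ _
      rw [e]
      exact glue_mem _ _

/-- Diagrams span, as the span contains the generators and is closed under all operations. -/
theorem mem_diagramSpan {m n : ℕ} (f : (obj m : TL0 k) ⟶ obj n) : f ∈ diagramSpan k m n := by
  suffices h : ∀ {m n : ℕ} (f : TLTerm k m n), (mk f : (obj m : TL0 k) ⟶ obj n) ∈
      diagramSpan k m n by
    obtain ⟨f, rfl⟩ := mk_surj f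
    exact h f
  obtain ⟨c, hc⟩ := CapDiagramTo.exists_toHom (k := k) cap .cap
  have hcap : glue k c .nil = cap := by
    rw [glue, hc]; exact Category.comp_id _
  have hcup : glue k .nil c = cup := by
    rw [glue, hc]; exact Category.id_comp _
  intro m n f
  induction f with
  | id n =>
    obtain ⟨x, hx⟩ := CapDiagramTo.exists_toHom_id (k := k) n
    have : glue k x x = 𝟙 (obj n : TL0 k) := by rw [glue, hx, bar_id, Category.comp_id]
    exact Set.mem_of_eq_of_mem this.symm (glue_mem x x)
  | cup => exact Set.mem_of_eq_of_mem hcup.symm (glue_mem .nil c)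
  | cap => exact Set.mem_of_eq_of_mem hcap.symm (glue_mem c .nil)
  | comp f g hf hg => exact comp_mem_diagramSpan hf hg
  | tensor f g hf hg => exact tensor_mem_diagramSpan hf hg
  | zero m n => exact Submodule.zero_mem _
  | add f g hf hg => exact Submodule.add_mem _ hf hg
  | smul a f hf => exact Submodule.smul_mem _ a hf

end TL0

/-! ### Faithfulness of the matrix representation -/

namespace Word

/-- The number of opening brackets minus the number of closing brackets. -/
def weight {n : ℕ} (u : Word n) : ℤ := ∑ i, if u i then 1 else -1

theorem weight_snoc {n : ℕ} (u : Word n) (b : Bool) :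
    weight (snoc u b) = weight u + if b then 1 else -1 := by
  simp [weight, Fin.sum_univ_castSucc]

theorem weight_fill {n t : ℕ} (x : CapDiagramTo n t) (w : Word t) :
    weight (x.fill w) = weight w := by
  induction x with
  | nil => rfl
  | through x ih =>
    obtain ⟨w, b, rfl⟩ := exists_snoc w
    rw [CapDiagramTo.fill_through, weight_snoc, weight_snoc, ih]
  | close x ih =>
    rw [CapDiagramTo.fill, weight_snoc, ih, weight_snoc]
    simp

theorem weight_le {n : ℕ} (u : Word n) : weight u ≤ n := by
  induction n with
  | zero => simp [weight]
  | succ n ih =>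
    obtain ⟨u, b, rfl⟩ := exists_snoc u
    have := ih u
    rw [weight_snoc]
    push_cast
    split_ifs <;> omega

/-- A word of length `n` and weight at least `n` consists of opening brackets only. -/
theorem eq_sorted_of_weight {n : ℕ} {u : Word n} (h : (n : ℤ) ≤ weight u) : u = sorted n 0 := by
  induction n with
  | zero => exact Subsingleton.elim _ _
  | succ n ih =>
    obtain ⟨u, b, rfl⟩ := exists_snoc u
    have h1 := weight_le u
    rw [weight_snoc] at h
    push_cast at h
    cases b
    · simp at h; omega
    · have hu := ih (u := u) (by simpa using h)
      rw [hu, sorted_succ]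
      simp

theorem weight_sorted_zero (n : ℕ) : weight (sorted n 0) = n := by
  simp [weight, sorted]

end Word

namespace TL0

variable {k : Type u} [Field k]

theorem homMat_glue {m n t : ℕ} (x : CapDiagramTo m t) (y : CapDiagramTo n t) (u : Word m)
    (v : Word n) :
    homMat (glue k x y) u v = iverson k (∃ w, u = x.fill w ∧ v = y.fill w) := by
  rw [glue, homMat_comp, homMat_bar, Matrix.mul_apply]
  have e (w : Word t) : TL0.homMat (x.toHom k) u w * (TL0.homMat (y.toHom k)).transpose w v =
      iverson k (u = x.fill w ∧ v = y.fill w) := by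
    rw [Matrix.transpose_apply, x.homMat_toHom k, y.homMat_toHom k, iverson_mul]
  exact (Finset.sum_congr rfl fun w _ => e w).trans
    (sum_iverson fun w w' h h' => x.fill_injective (h.1.symm.trans h'.1))

/-- Diagrams have linearly independent matrices: in a vanishing linear combination, the entry at the
highest weight words of the halves of a diagram with as many through-strands as possible receives no
other contribution. -/
theorem linearIndependent_homMat_glue (m n : ℕ) : LinearIndependent k
    fun p : Σ t, CapDiagramTo m t × CapDiagramTo n t =>
      homMatLinear (obj m) (obj n) (glue k p.2.1 p.2.2) := by
  classical
  rw [linearIndependent_iff']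
  intro s g hg
  by_contra! hs
  obtain ⟨i, hi, hgi⟩ := hs
  obtain ⟨⟨t, x, y⟩, hp, hmax⟩ := Finset.exists_max_image (s.filter (g · ≠ 0)) (fun p => p.1)
    ⟨i, Finset.mem_filter.2 ⟨hi, hgi⟩⟩
  obtain ⟨hps, hgp⟩ := Finset.mem_filter.1 hp
  refine hgp ?_
  have h := congrFun (congrFun hg (x.fill (sorted t 0))) (y.fill (sorted t 0))
  rw [Matrix.sum_apply, Finset.sum_eq_single_of_mem _ hps] at h
  · have e := homMat_glue (k := k) x y (x.fill (sorted t 0)) (y.fill (sorted t 0))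
    rw [iverson_true ⟨_, rfl, rfl⟩] at e
    have e' : g ⟨t, x, y⟩ * homMat (glue k x y) (x.fill (sorted t 0)) (y.fill (sorted t 0)) = 0 :=
      h
    rwa [e, mul_one] at e'
  · rintro ⟨t', x', y'⟩ hp' hne
    by_cases hg' : g ⟨t', x', y'⟩ = 0
    · rw [hg', zero_smul]; rfl
    have hle : t' ≤ t := hmax _ (Finset.mem_filter.2 ⟨hp', hg'⟩)
    have e := homMat_glue (k := k) x' y' (x.fill (sorted t 0)) (y.fill (sorted t 0))
    rw [iverson_false] at e
    · exact (congrArg (g ⟨t', x', y'⟩ * ·) e).trans (mul_zero _)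
    · rintro ⟨w, hx, hy⟩
      -- Cap diagrams preserve weights, and no word of length `t' < t` has weight `t`.
      have hw := congrArg weight hx
      rw [weight_fill, weight_fill, weight_sorted_zero] at hw
      have := weight_le w
      obtain rfl : t' = t := by omega
      obtain rfl := eq_sorted_of_weight hw.le
      have hx' := (x.parse_fill_sorted (Nat.zero_le _)).1
      have hy' := (y.parse_fill_sorted (Nat.zero_le _)).1
      rw [hx, (x'.parse_fill_sorted (Nat.zero_le _)).1] at hx'
      rw [hy, (y'.parse_fill_sorted (Nat.zero_le _)).1] at hy'
      cases hx'
      cases hy'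
      exact hne rfl

/-- The matrix representation is faithful. -/
theorem homMat_injective {m n : ℕ} {f g : (obj m : TL0 k) ⟶ obj n} (h : homMat f = homMat g) :
    f = g := by
  rw [← sub_eq_zero]
  obtain ⟨c, hc⟩ := (Finsupp.mem_span_range_iff_exists_finsupp).1 (mem_diagramSpan (f - g))
  have h0 : homMatLinear (obj m) (obj n) (f - g) = 0 := by
    rw [map_sub, sub_eq_zero]; exact h
  rw [← hc, Finsupp.sum, map_sum] at h0
  simp only [map_smul] at h0
  have hc0 := linearIndependent_iff'.1 (linearIndependent_homMat_glue (k := k) m n) _ _ h0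
  rw [← hc, Finsupp.sum]
  exact Finset.sum_eq_zero fun i hi => by rw [hc0 i hi, zero_smul]

/-- Every morphism commutes with `evac`. -/
theorem homMat_evac {m n : ℕ} (f : (obj m : TL0 k) ⟶ obj n) (u : Word m) (v : Word n) :
    homMat f (evac u) (evac v) = homMat f u v := by
  have hf := mem_diagramSpan f
  induction hf using Submodule.span_induction with
  | zero => rfl
  | add f g _ _ hf hg =>
    have e := map_add (homMatLinear (obj m) (obj n)) f g
    change homMat (f + g) = homMat f + homMat g at e
    rw [e, Matrix.add_apply, Matrix.add_apply, hf, hg]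
  | smul a f _ hf =>
    rw [homMat_smul, Matrix.smul_apply, Matrix.smul_apply, hf]
  | mem f hf =>
    obtain ⟨⟨t, x, y⟩, rfl⟩ := hf
    simp only [glue, homMat_comp, homMat_bar, Matrix.mul_apply, Matrix.transpose_apply]
    refine (Function.Bijective.sum_comp (Function.Involutive.bijective evac_evac)
      (fun w => homMat (x.toHom k) (evac u) w * homMat (y.toHom k) (evac v) w)).symm.trans ?_
    refine Finset.sum_congr rfl fun w _ => ?_
    exact congrArg₂ (· * ·) (homMat_toHom_evac k x u w) (homMat_toHom_evac k y v w)

end TL0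

/-! ### The axioms of a coboundary category on words -/

namespace Word

/-- Transport of words along an equality of lengths. -/
def reindex {m n : ℕ} (h : m = n) (u : Word m) : Word n := fun i => u (i.cast h.symm)

theorem comm_append {m n : ℕ} (u : Word m) (v : Word n) :
    comm m n (Fin.append u v) = evac (Fin.append (evac v) (evac u)) := by
  rw [comm, exchange_append]

theorem evac_comm_append {m n : ℕ} (u : Word m) (v : Word n) :
    evac (comm m n (Fin.append u v)) = Fin.append (evac v) (evac u) := by
  rw [comm_append, evac_evac]

theorem evac_reindex {m n : ℕ} (h : m = n) (u : Word m) :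
    evac (reindex h u) = reindex h (evac u) := by
  subst h; rfl

theorem reindex_append_assoc {m n p : ℕ} (u : Word m) (v : Word n) (w : Word p) :
    reindex (Nat.add_assoc m n p) (Fin.append (Fin.append u v : Word (m + n)) w) =
      Fin.append u (Fin.append v w : Word (n + p)) := by
  rw [Fin.append_assoc]; rfl

theorem reindex_symm_append_assoc {m n p : ℕ} (u : Word m) (v : Word n) (w : Word p) :
    reindex (Nat.add_assoc m n p).symm (Fin.append u (Fin.append v w : Word (n + p))) =
      Fin.append (Fin.append u v : Word (m + n)) w := by
  rw [← reindex_append_assoc]; rfl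

theorem comm_zero {n : ℕ} (u : Word (0 + n)) : comm 0 n u = reindex (Nat.zero_add n) u := by
  obtain ⟨v, w, rfl⟩ := exists_append u
  rw [comm_append, Subsingleton.elim v Fin.elim0, Subsingleton.elim (evac _) Fin.elim0,
    Fin.append_elim0, Fin.elim0_append]
  exact evac_evac w

/-- The cactus axiom: both sides reverse the order of the three parts, apply `evac` to each of them,
and finally apply `evac` to the whole word. -/
theorem cactus {r s t : ℕ} (u : Word r) (v : Word s) (w : Word t) :
    comm r (t + s) (Fin.append u (comm s t (Fin.append v w) : Word (t + s))) =
      reindex (Nat.add_assoc t s r).symm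
        (comm (s + r) t (Fin.append (comm r s (Fin.append u v) : Word (s + r)) w)) := by
  rw [comm_append u, evac_comm_append, comm_append _ w, evac_comm_append, ← evac_reindex,
    reindex_symm_append_assoc]

end Word

namespace TL0

variable {k : Type u} [Field k]

/-- The matrix of `f` is the graph of the function `φ`. -/
def IsGraph {m n : ℕ} (f : (obj m : TL0 k) ⟶ obj n) (φ : Word m → Word n) : Prop :=
  ∀ u v, homMat f u v = iverson k (v = φ u)

theorem IsGraph.ext {m n : ℕ} {f g : (obj m : TL0 k) ⟶ obj n} {φ ψ : Word m → Word n}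
    (hf : IsGraph f φ) (hg : IsGraph g ψ) (h : ∀ u, φ u = ψ u) : f = g := by
  refine homMat_injective (Matrix.ext fun u v => ?_)
  rw [hf, hg, h]

theorem isGraph_id (m : ℕ) : IsGraph (𝟙 (obj m : TL0 k)) id := fun u v =>
  (one_apply_eq_iverson u v).trans (iverson_congr eq_comm)

theorem isGraph_eqToHom {m n : ℕ} (h : m = n) :
    IsGraph (eqToHom (congrArg obj h) : (obj m : TL0 k) ⟶ obj n) (reindex h) := by
  subst h; exact isGraph_id m

theorem IsGraph.homMat_comp {l m n : ℕ} {f : (obj l : TL0 k) ⟶ obj m} {φ : Word l → Word m}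
    (hf : IsGraph f φ) (g : (obj m : TL0 k) ⟶ obj n) (u : Word l) (v : Word n) :
    homMat (f ≫ g) u v = homMat g (φ u) v := by
  classical
  rw [TL0.homMat_comp, Matrix.mul_apply, Finset.sum_eq_single (φ u)]
  · exact (congrArg (· * homMat g (φ u) v) ((hf _ _).trans (iverson_true rfl))).trans (one_mul _)
  · intro w _ hw
    exact (congrArg (· * homMat g w v) ((hf _ _).trans (iverson_false hw))).trans (zero_mul _)
  · intro h; exact absurd (Finset.mem_univ _) h

theorem IsGraph.comp_homMat {l m n : ℕ} (f : (obj l : TL0 k) ⟶ obj m)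
    {g : (obj m : TL0 k) ⟶ obj n} {ψ : Word m → Word n} (hg : IsGraph g ψ)
    (hψ : Function.Injective ψ) (u : Word l) (v : Word m) :
    homMat (f ≫ g) u (ψ v) = homMat f u v := by
  classical
  rw [TL0.homMat_comp, Matrix.mul_apply, Finset.sum_eq_single v]
  · exact (congrArg (homMat f u v * ·) ((hg _ _).trans (iverson_true rfl))).trans (mul_one _)
  · intro w _ hw
    exact (congrArg (homMat f u w * ·) ((hg _ _).trans
      (iverson_false fun h => hw (hψ h).symm))).trans (mul_zero _)
  · intro h; exact absurd (Finset.mem_univ _) h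

theorem IsGraph.comp {l m n : ℕ} {f : (obj l : TL0 k) ⟶ obj m} {g : (obj m : TL0 k) ⟶ obj n}
    {φ : Word l → Word m} {ψ : Word m → Word n} (hf : IsGraph f φ) (hg : IsGraph g ψ) :
    IsGraph (f ≫ g) (fun u => ψ (φ u)) := fun u v => by
  rw [hf.homMat_comp, hg]

theorem IsGraph.tensor {m n m' n' : ℕ} {f : (obj m : TL0 k) ⟶ obj n}
    {g : (obj m' : TL0 k) ⟶ obj n'} {φ : Word m → Word n} {ψ : Word m' → Word n'}
    (hf : IsGraph f φ) (hg : IsGraph g ψ) :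
    IsGraph (m := m + m') (n := n + n') (f ⊗ₘ g) (fun u =>
      Fin.append (φ fun i => u (i.castAdd m') : Word n) (ψ fun i => u (i.natAdd m) : Word n')) := by
  intro u v
  obtain ⟨u, u', rfl⟩ := exists_append u
  obtain ⟨v, v', rfl⟩ := exists_append v
  rw [homMat_tensor, hf, hg, iverson_mul, append_inj]
  simp only [Fin.append_left, Fin.append_right]

theorem isGraph_commutor (m n : ℕ) :
    IsGraph (m := m + n) (n := n + m) (commutor k m n) (comm m n) := homMat_commutor k m n

theorem commutor_symmetry (m n : ℕ) :
    commutor k m n ≫ commutor k n m = 𝟙 (obj m ⊗ obj n : TL0 k) :=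
  ((isGraph_commutor m n).comp (isGraph_commutor n m)).ext (isGraph_id (m + n)) comm_comm

/-- Naturality: since every morphism commutes with `evac`, the outer `evac` of the commutor can be
removed on both sides, and `exchange` is visibly natural. -/
theorem commutor_naturality {m m' n n' : ℕ} (f : (obj m : TL0 k) ⟶ obj m')
    (g : (obj n : TL0 k) ⟶ obj n') :
    (f ⊗ₘ g) ≫ commutor k m' n' = commutor k m n ≫ (g ⊗ₘ f) := by
  refine homMat_injective (m := m + n) (n := n' + m') (Matrix.ext fun u v => ?_)
  obtain ⟨v, rfl⟩ : ∃ w, v = comm m' n' w := ⟨comm n' m' v, (comm_comm v).symm⟩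
  refine ((isGraph_commutor m' n').comp_homMat (l := m + n) (f ⊗ₘ g)
    (Function.LeftInverse.injective comm_comm) u v).trans ?_
  refine Eq.trans ?_ ((isGraph_commutor m n).homMat_comp (n := n' + m') (g ⊗ₘ f) u _).symm
  refine Eq.trans ?_ (homMat_evac (m := n + m) (n := n' + m') (g ⊗ₘ f)
    (exchange m n u) (exchange m' n' v)).symm
  obtain ⟨u, u', rfl⟩ := exists_append u
  obtain ⟨v, v', rfl⟩ := exists_append v
  rw [exchange_append, exchange_append, homMat_tensor, homMat_tensor, homMat_evac, homMat_evac,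
    mul_comm]

theorem commutor_unit (n : ℕ) :
    commutor k 0 n = (λ_ (obj n : TL0 k)).hom ≫ (ρ_ (obj n : TL0 k)).inv :=
  (isGraph_commutor 0 n).ext ((isGraph_eqToHom (Nat.zero_add n)).comp (isGraph_id n)) comm_zero

theorem commutor_cactus (r s t : ℕ) :
    (obj r : TL0 k) ◁ commutor k s t ≫ commutor k r (t + s) =
      (α_ (obj r : TL0 k) (obj s) (obj t)).inv ≫ commutor k r s ▷ (obj t : TL0 k) ≫
        commutor k (s + r) t ≫ (α_ (obj t : TL0 k) (obj s) (obj r)).inv := by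
  have h1 : IsGraph (m := r + (s + t)) (n := r + (t + s)) ((obj r : TL0 k) ◁ commutor k s t) _ :=
    (isGraph_id r).tensor (isGraph_commutor s t)
  have h2 : IsGraph (m := r + s + t) (n := s + r + t) (commutor k r s ▷ (obj t : TL0 k)) _ :=
    (isGraph_commutor r s).tensor (isGraph_id t)
  refine (h1.comp (isGraph_commutor r (t + s))).ext
    ((isGraph_eqToHom (Nat.add_assoc r s t).symm).comp (h2.comp
      ((isGraph_commutor (s + r) t).comp (isGraph_eqToHom (Nat.add_assoc t s r).symm))))
    fun u => ?_
  obtain ⟨u, v, rfl⟩ := exists_append u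
  obtain ⟨v, w, rfl⟩ := exists_append v
  rw [reindex_symm_append_assoc]
  simp only [Fin.append_left, Fin.append_right]
  exact cactus u v w

end TL0

theorem mainTheorem2 (k : Type u) [Field k] :
    ∃ c : CoboundaryStructure (TL0 k),
      ∀ m n : ℕ, (c.σ (TL0.obj m) (TL0.obj n)).hom = commutor k m n :=
  ⟨{  σ := fun A B =>
        { hom := commutor k A.strands B.strands
          inv := commutor k B.strands A.strands
          hom_inv_id := TL0.commutor_symmetry _ _
          inv_hom_id := TL0.commutor_symmetry _ _ }
      naturality := fun f g => TL0.commutor_naturality f g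
      symmetry := fun _ _ => TL0.commutor_symmetry _ _
      unit := fun _ => TL0.commutor_unit _
      cactus := fun _ _ _ => TL0.commutor_cactus _ _ _ }, fun _ _ => rfl⟩
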